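/- All alphabets are finite, and languages and functions are over such alphabets. Let $\mathrm{REG}$ and $\mathrm{CFL}$ be the families of regular and of context-free languages, and let $\mathrm{CFL}(k)=\{\bigcap_{i=1}^k A_i \mid A_1,\dots,A_k\in\mathrm{CFL}\}$, where $A_1,\dots,A_k$ are over a common alphabet. For a language family $\mathcal C$, $\mathrm{co}\,\mathcal C$ is the family of complements $\Sigma^*\setminus L$ of the languages $L\subseteq\Sigma^*$ in $\mathcal C$. An npda is a one-way one-head nondeterministic pushdown automaton, with $\lambda$-moves, whose input is placed between two endmarkers. It has disjoint sets of accepting and rejecting states, which are its halting states, and it is required that all of its computation paths reach a halting state within $O(n)$ steps on inputs of length $n$. It may have write-only tapes, on each of which every move writes at most one symbol. A multi-valued partial function $f:\Sigma^*\to\mathcal P(\Gamma^*)$ is in $\mathrm{CFLMV}$ if some npda with a write-only output tape produces, for every $x\in\Sigma^*$, exactly the strings in $f(x)$ as its outputs along the accepting computation paths on $x$. The class $\mathrm{CFLSV}_t$ consists of those $f\in\mathrm{CFLMV}$ with $|f(x)|=1$ for all $x$. For strings $x,y$, let $\left[{x\atop y}\right]$ be the string of pairs of symbols with upper track $x$ and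 lower track $y$, the shorter of the two strings being padded at its end with a new symbol $\#$. For a language family $\mathcal C$ and a function class $\mathcal F$, let $\mathcal C/\!/\mathcal F$ be the family of languages $L=\{x \mid \exists y\in h(x)\ \left[{x\atop y}\right]\in B\}$ with $B\in\mathcal C$ and $h\in\mathcal F$. For a language $A$, $\mathrm{CFLSV}_m^A$ is the class of functions $f$ with $|f(x)|\le 1$ for all $x$ for which there is an npda $M$ with two write-only tapes, an output tape and a query tape, such that for every $x$, $f(x)$ is the set of the strings $z_p$ for which $p$ is an accepting computation path of $M$ on $x$ with output string $z_p$ whose query string $y_p$ belongs to $A$. Let $\mathrm{CFL}_m^A$ be the family of languages $L$ such that the function $\eta_L$, with $\eta_L(x)=\{1\}$ if $x\in L$ and $\eta_L(x)=\emptyset$ otherwise, is in $\mathrm{CFLSV}_m^A$, and let $\mathrm{CFL}_m^{\mathcal C}=\bigcup_{A\in\mathcal C}\mathrm{CFL}_m^A$. **Proposition.** 1. $\mathrm{REG}/\!/\mathrm{CFLSV}_t\subseteq \mathrm{CFL}_m^{\mathrm{CFL}(2)}\cap \mathrm{co}\,\mathrm{CFL}_m^{\mathrm{CFL}(2)}$.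 2. $\mathrm{CFL}/\!/\mathrm{CFLSV}_t\subseteq \mathrm{CFL}_m^{\mathrm{CFL}(3)}$. -/

import Mathlib

namespace CFLFun

/-! ### Languages, functions, and families of them

Alphabets are finite types.  A multi-valued partial function from `α*` to `γ*` is a map
`List α → Set (List γ)`; it is undefined at `x` when its value there is empty. -/

/-- A family of languages, sorted by the alphabet. -/
abbrev LanguageFamily : Type 1 := ∀ α : Type, Set (Language α)

/-- Multi-valued partial functions from `α*` to `γ*`. -/
abbrev MVFun (α γ : Type) : Type := List α → Set (List γ)

/-- A family of multi-valued partial functions, sorted by the input and output alphabets. -/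
abbrev FunctionFamily : Type 1 := ∀ α γ : Type, Set (MVFun α γ)

/-- The family of regular languages. -/
def REG : LanguageFamily := fun _ => {L | L.IsRegular}

/-- The family of context-free languages. -/
def CFL : LanguageFamily := fun _ => {L | L.IsContextFree}

/-- The `k`-conjunctive closure of `CFL`: intersections of `k` context-free languages over
a common alphabet. -/
def CFLConj (k : ℕ) : LanguageFamily := fun α =>
  {L | ∃ A : Fin k → Language α, (∀ i, A i ∈ CFL α) ∧ L = {w | ∀ i, w ∈ A i}}

/-- Complements of the members of a language family. -/
def co (C : LanguageFamily) : LanguageFamily := fun α => {L | Lᶜ ∈ C α}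

/-! ### Nondeterministic pushdown automata with write-only tapes -/

/-- Contents of an input tape cell: an input symbol or one of the two endmarkers. -/
inductive TapeSymbol (α : Type) : Type
  | left : TapeSymbol α
  | sym : α → TapeSymbol α
  | right : TapeSymbol α

/-- One-way nondeterministic pushdown automata over the input alphabet `α`.  Every move emits
an element of `ω`, recording what is written on the write-only tape(s): `ω = Option γ` for one
output tape over `γ`, and `ω = Option γ × Option δ` for an output tape over `γ` and a query tape
over `δ` (`none`: nothing is written on that tape).  In `trans q s z`, the argument `s` is the
tape symbol that is read, or `none` for a `λ`-move, and `z` is the topmost stack symbol, which is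
replaced by a string of stack symbols (topmost symbol first). -/
structure NPDA (α ω : Type) : Type 1 where
  State : Type
  Stack : Type
  finite_state : Finite State
  finite_stack : Finite Stack
  start : State
  bottom : Stack
  acc : Set State
  rej : Set State
  disjoint_acc_rej : Disjoint acc rej
  trans : State → Option (TapeSymbol α) → Stack → Set (State × List Stack × ω)
  finite_trans : ∀ q s z, (trans q s z).Finite

namespace NPDA

variable {α ω : Type}

/-- A configuration: inner state, unread part of the input tape, stack (topmost first). -/
structure Config (M : NPDA α ω) : Type where
  state : M.State
  input : List (TapeSymbol α)
  stack : List M.Stack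

/-- The halting states. -/
def halt (M : NPDA α ω) : Set M.State := M.acc ∪ M.rej

/-- The initial configuration: the input tape holds `x` between the endmarkers and the stack
holds only the bottom marker. -/
def init (M : NPDA α ω) (x : List α) : M.Config :=
  ⟨M.start, TapeSymbol.left :: (x.map TapeSymbol.sym ++ [TapeSymbol.right]), [M.bottom]⟩

/-- `M.Step c w c'`: one move from `c` to `c'` with emission `w`.  There is no move from a
halting state. -/
inductive Step (M : NPDA α ω) : M.Config → ω → M.Config → Prop
  | read {q q' : M.State} {s : TapeSymbol α} {u : List (TapeSymbol α)} {z : M.Stack}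
      {v β : List M.Stack} {w : ω} :
      q ∉ M.halt → (q', β, w) ∈ M.trans q (some s) z →
      Step M ⟨q, s :: u, z :: v⟩ w ⟨q', u, β ++ v⟩
  | silent {q q' : M.State} {u : List (TapeSymbol α)} {z : M.Stack}
      {v β : List M.Stack} {w : ω} :
      q ∉ M.halt → (q', β, w) ∈ M.trans q none z →
      Step M ⟨q, u, z :: v⟩ w ⟨q', u, β ++ v⟩

/-- `M.Run c l c'`: a sequence of `l.length` moves from `c` to `c'`; `l` lists the emissions. -/
inductive Run (M : NPDA α ω) : M.Config → List ω → M.Config → Prop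
  | nil (c : M.Config) : Run M c [] c
  | cons {c c' c'' : M.Config} {w : ω} {l : List ω} :
      M.Step c w c' → Run M c' l c'' → Run M c (w :: l) c''

/-- The termination condition: on inputs of length `n`, all computation paths reach a halting
state within `O(n)` steps.  That is, all partial computations have at most `a * n + b` steps, and
a computation gets stuck only in halting states. -/
def Terminates (M : NPDA α ω) : Prop :=
  ∃ a b : ℕ, ∀ (x : List α) (l : List ω) (c : M.Config), M.Run (M.init x) l c →
    l.length ≤ a * x.length + b ∧ (c.state ∉ M.halt → ∃ w c', M.Step c w c')

/-- `l` is the list of emissions along some accepting computation path on `x`. -/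
def Accepts (M : NPDA α ω) (x : List α) (l : List ω) : Prop :=
  ∃ c : M.Config, M.Run (M.init x) l c ∧ c.state ∈ M.acc

/-- The valid outcomes on `x` of an npda with an output tape. -/
def outcomes {γ : Type} (M : NPDA α (Option γ)) (x : List α) : Set (List γ) :=
  {y | ∃ l, M.Accepts x l ∧ y = l.reduceOption}

/-- The outcomes on `x` of an oracle npda (first tape: output, second tape: query), along the
accepting computation paths whose query string belongs to the oracle `A`. -/
def oracleOutcomes {γ δ : Type} (M : NPDA α (Option γ × Option δ)) (A : Language δ)
    (x : List α) : Set (List γ) :=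
  {z | ∃ l, M.Accepts x l ∧ (l.map Prod.snd).reduceOption ∈ A ∧
    z = (l.map Prod.fst).reduceOption}

end NPDA

/-! ### Classes of CFL functions -/

/-- Functions computed by npda's with an output tape. -/
def CFLMV : FunctionFamily := fun α γ =>
  {f | ∃ M : NPDA α (Option γ), M.Terminates ∧ ∀ x, f x = M.outcomes x}

/-- The single-valued partial functions in `CFLMV`. -/
def CFLSV : FunctionFamily := fun α γ => {f | f ∈ CFLMV α γ ∧ ∀ x, (f x).Subsingleton}

/-- The total functions in `CFLSV`. -/
def CFLSVt : FunctionFamily := fun α γ => {f | f ∈ CFLSV α γ ∧ ∀ x, (f x).Nonempty}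

/-! ### Many-one relativization -/

/-- The functions many-one relative to the oracle `A`. -/
def CFLMVm {δ : Type} (A : Language δ) : FunctionFamily := fun α γ =>
  {f | ∃ M : NPDA α (Option γ × Option δ), M.Terminates ∧ ∀ x, f x = M.oracleOutcomes A x}

/-- The single-valued functions in `CFLMVm A`. -/
def CFLSVm {δ : Type} (A : Language δ) : FunctionFamily := fun α γ =>
  {f | f ∈ CFLMVm A α γ ∧ ∀ x, (f x).Subsingleton}

/-- The quasi-characteristic function of `L`: it has the value `1` on `L` and is undefined
elsewhere. -/
def quasiChar {α : Type} (L : Language α) : MVFun α (Fin 2) := fun x => {y | x ∈ L ∧ y = [1]}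

/-- The languages many-one relative to the oracle `A`. -/
def CFLmOracle {δ : Type} (A : Language δ) : LanguageFamily := fun α =>
  {L | quasiChar L ∈ CFLSVm A α (Fin 2)}

/-- The languages many-one relative to some oracle, over a finite alphabet, in the family `C`. -/
def CFLm (C : LanguageFamily) : LanguageFamily := fun α =>
  {L | ∃ δ : Type, Finite δ ∧ ∃ A ∈ C δ, L ∈ CFLmOracle A α}

/-! ### The advice operator -/

/-- The two-track string with upper track `x` and lower track `y`; the shorter of the two strings
is padded at its end by the new symbol `none`. -/
def track {α γ : Type} (x : List α) (y : List γ) : List (Option α × Option γ) :=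
  List.zipWithAll Prod.mk x y

/-- The class `C // F` of languages recognized with advice functions in `F`. -/
def advice (C : LanguageFamily) (F : FunctionFamily) : LanguageFamily := fun α =>
  {L | ∃ γ : Type, Finite γ ∧ ∃ B ∈ C (Option α × Option γ), ∃ h ∈ F α γ,
    L = {x | ∃ y ∈ h x, track x y ∈ B}}

end CFLFun

/-!
Let `M` be an npda for the advice. An oracle npda decides whether `track x y ∈ B` for some output
`y` of `M` on `x` as follows. While it reads `x`, it guesses and pushes a two-track string `u`, the
reversal of a computation history, and a computation history `w` of `M`; then it pops and repeats
its guesses. Its query thus has the form `u wᴿ w` followed by `wᴿ w uᴿ`, the tape contents being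
recorded alongside the guesses of the first part.

A history is an accepting computation followed by the unread tape symbols, so that the tape contents
and the output can both be read off it. By the triple construction, histories form a context-free
language, and a context-free language can compare two adjacent blocks of opposite orientation.
One oracle checks that `u ∈ B`, that the two guessed copies of `w` agree, that the repeated `wᴿ` is
a reversed history of `M`, and that the final `w uᴿ` has the input of `w` as the upper track of `u`.
The other checks that the recorded tape contents are those of the `wᴿ` next to them, and that the
final `w uᴿ` has the output of `w` as the lower track of `u`.

If the advice is total and single-valued, replacing `B` by its complement complements the language.
-/

namespace CFLFun

/-! ### Regular and context-free languages -/

theorem isRegular_top {T : Type} : (⊤ : Language T).IsRegular :=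
  ⟨Unit, inferInstance, ⟨fun _ _ => (), (), Set.univ⟩, Set.eq_univ_of_forall fun _ => trivial⟩

theorem isRegular_setOf_forall_and_pairwise {A : Type} [Finite A] (P : A → Prop)
    (R : A → A → Prop) : Language.IsRegular {l : List A | (∀ c ∈ l, P c) ∧ l.Pairwise R} := by
  apply Language.IsRegular.of_finite_range_leftQuotient
  refine (Set.toFinite (Set.range fun x : Prop × Set A =>
    ({y | x.1 ∧ (∀ c ∈ y, P c) ∧ y.Pairwise R ∧ ∀ a ∈ x.2, ∀ b ∈ y, R a b} : Language A))).subset ?_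
  rintro _ ⟨l, rfl⟩
  refine ⟨((∀ c ∈ l, P c) ∧ l.Pairwise R, {c | c ∈ l}), ?_⟩
  ext y
  change (_ ∧ _) ↔ (∀ c ∈ l ++ y, P c) ∧ (l ++ y).Pairwise R
  simp only [List.forall_mem_append, List.pairwise_append, Set.mem_ofPred_eq]
  tauto

/-- `Parse R β s`: the sentential form `β` derives the word `s` by the context-free rules `R`.
Contrary to `ContextFreeGrammar.Derives`, it supports structural induction on parse trees. -/
inductive Parse {T N : Type} (R : N → List (Symbol T N) → Prop) : List (Symbol T N) → List T → Prop
  | nil : Parse R [] []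
  | term {a : T} {β : List (Symbol T N)} {s : List T} :
      Parse R β s → Parse R (.terminal a :: β) (a :: s)
  | nonterm {A : N} {rhs β : List (Symbol T N)} {s t : List T} :
      R A rhs → Parse R rhs s → Parse R β t → Parse R (.nonterminal A :: β) (s ++ t)

/-- The meaning of a sentential form when the words derived from each nonterminal are given
by `I`. -/
def Interprets {T N : Type} (I : N → List T → Prop) : List (Symbol T N) → List T → Prop
  | [], s => s = []
  | .terminal a :: β, s => ∃ t, s = a :: t ∧ Interprets I β t
  | .nonterminal A :: β, s => ∃ u v, I A u ∧ Interprets I β v ∧ s = u ++ v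

namespace Parse

variable {T N : Type} {R : N → List (Symbol T N) → Prop}

theorem interprets {I : N → List T → Prop} (hI : ∀ A rhs s, R A rhs → Interprets I rhs s → I A s)
    {β : List (Symbol T N)} {s : List T} (h : Parse R β s) : Interprets I β s := by
  induction h with
  | nil => rfl
  | term _ ih => exact ⟨_, rfl, ih⟩
  | nonterm hr _ _ ih₁ ih₂ => exact ⟨_, _, hI _ _ _ hr ih₁, ih₂, rfl⟩

theorem nil_iff {s : List T} : Parse R [] s ↔ s = [] :=
  ⟨fun h => by cases h; rfl, fun h => h ▸ .nil⟩

theorem term_iff {a : T} {β : List (Symbol T N)} {s : List T} :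
    Parse R (.terminal a :: β) s ↔ ∃ t, s = a :: t ∧ Parse R β t :=
  ⟨fun h => by cases h with | term h => exact ⟨_, rfl, h⟩, by rintro ⟨t, rfl, h⟩; exact .term h⟩

theorem nonterm_iff {A : N} {β : List (Symbol T N)} {s : List T} :
    Parse R (.nonterminal A :: β) s ↔
      ∃ rhs u v, R A rhs ∧ Parse R rhs u ∧ Parse R β v ∧ s = u ++ v :=
  ⟨fun h => by cases h with | nonterm h h₁ h₂ => exact ⟨_, _, _, h, h₁, h₂, rfl⟩,
    by rintro ⟨rhs, u, v, h, h₁, h₂, rfl⟩; exact .nonterm h h₁ h₂⟩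

theorem of_rule {A : N} {rhs : List (Symbol T N)} {s : List T} (h : R A rhs) (hs : Parse R rhs s) :
    Parse R [.nonterminal A] s := by
  simpa only [List.append_nil] using nonterm h hs nil

theorem append {β β' : List (Symbol T N)} {s s' : List T} (h : Parse R β s) (h' : Parse R β' s') :
    Parse R (β ++ β') (s ++ s') := by
  induction h with
  | nil => exact h'
  | term _ ih => exact .term ih
  | nonterm hr h₁ _ _ ih => simpa only [List.append_assoc] using .nonterm hr h₁ ih

theorem exists_of_append {β β' : List (Symbol T N)} {s : List T} (h : Parse R (β ++ β') s) :
    ∃ u v, Parse R β u ∧ Parse R β' v ∧ s = u ++ v := by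
  induction β generalizing s with
  | nil => exact ⟨[], s, .nil, h, rfl⟩
  | cons a β ih =>
    cases a with
    | terminal a =>
      obtain ⟨t, rfl, ht⟩ := term_iff.1 h
      obtain ⟨u, v, hu, hv, rfl⟩ := ih ht
      exact ⟨a :: u, v, .term hu, hv, rfl⟩
    | nonterminal A =>
      obtain ⟨rhs, t, t', hr, ht, ht', rfl⟩ := nonterm_iff.1 h
      obtain ⟨u, v, hu, hv, rfl⟩ := ih ht'
      exact ⟨t ++ u, v, .nonterm hr ht hu, hv, (List.append_assoc t u v).symm⟩

theorem map_terminal (R : N → List (Symbol T N) → Prop) (s : List T) :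
    Parse R (s.map .terminal) s := by
  induction s with
  | nil => exact .nil
  | cons a s ih => exact .term ih

theorem derives_iff (g : ContextFreeGrammar T) {β : List (Symbol T g.NT)} {s : List T} :
    g.Derives β (s.map .terminal) ↔ Parse (fun A rhs => ⟨A, rhs⟩ ∈ g.rules) β s := by
  constructor
  · intro h
    induction h using Relation.ReflTransGen.head_induction_on with
    | refl => exact map_terminal _ s
    | head h _ ih =>
      obtain ⟨r, hr, h⟩ := h
      obtain ⟨p, q, rfl, rfl⟩ := h.exists_parts
      obtain ⟨u, v, hu, hv, rfl⟩ := exists_of_append ih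
      obtain ⟨u₁, u₂, hu₁, hu₂, rfl⟩ := exists_of_append hu
      exact (hu₁.append (of_rule hr hu₂)).append hv
  · intro h
    induction h with
    | nil => exact .refl _
    | term _ ih => exact ih.append_left [_]
    | @nonterm A rhs β s t hr _ _ ih₁ ih₂ =>
      have unfold_head : g.Produces (.nonterminal A :: β) (rhs ++ β) :=
        ⟨_, hr, ContextFreeRule.Rewrites.head (r := ⟨A, rhs⟩) β⟩
      rw [List.map_append]
      exact unfold_head.trans_derives ((ih₁.append_right β).trans (ih₂.append_left _))

end Parse

theorem isContextFree_iff_exists_rules {T : Type} {L : Language T} :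
    L.IsContextFree ↔ ∃ (N : Type) (R : N → List (Symbol T N) → Prop) (A : N),
      {p : N × List (Symbol T N) | R p.1 p.2}.Finite ∧
        ∀ s, s ∈ L ↔ Parse R [.nonterminal A] s := by
  classical
  let rule (N : Type) : N × List (Symbol T N) ≃ ContextFreeRule T N :=
    ⟨fun p => ⟨p.1, p.2⟩, fun r => (r.input, r.output), fun _ => rfl, fun _ => rfl⟩
  constructor
  · rintro ⟨g, rfl⟩
    have finite_rules : (rule g.NT ⁻¹' g.rules).Finite :=
      g.rules.finite_toSet.preimage (rule g.NT).injective.injOn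
    refine ⟨g.NT, fun A rhs => rule g.NT (A, rhs) ∈ g.rules, g.initial, finite_rules, fun s => ?_⟩
    exact (ContextFreeGrammar.mem_language_iff g s).trans (Parse.derives_iff g)
  · rintro ⟨N, R, A, hR, hL⟩
    let g : ContextFreeGrammar T := ⟨N, A, hR.toFinset.map (rule N).toEmbedding⟩
    have hg : (fun A rhs => (⟨A, rhs⟩ : ContextFreeRule T N) ∈ g.rules) = R := by
      funext B rhs
      exact propext <| (Finset.mem_map' (rule N).toEmbedding (a := (B, rhs))).trans
        hR.mem_toFinset
    refine ⟨g, ?_⟩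
    ext s
    rw [ContextFreeGrammar.mem_language_iff, Parse.derives_iff, hg, hL]

/-- Two symbols correspond when they are terminals related by `ρ`, or a nonterminal `A` on the
right and its new name `f A` on the left. -/
inductive SymbolRel {T T' N N' : Type} (ρ : T' → T → Prop) (f : N → N') :
    Symbol T' N' → Symbol T N → Prop
  | terminal {b : T'} {a : T} : ρ b a → SymbolRel ρ f (.terminal b) (.terminal a)
  | nonterminal (A : N) : SymbolRel ρ f (.nonterminal (f A)) (.nonterminal A)

section Relabel

variable {T T' N N' : Type} {ρ : T' → T → Prop} {f : N → N'}
  {R : N → List (Symbol T N) → Prop} {R' : N' → List (Symbol T' N') → Prop}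

theorem Parse.exists_relabel
    (hR : ∀ A rhs', R' (f A) rhs' → ∃ rhs, R A rhs ∧ List.Forall₂ (SymbolRel ρ f) rhs' rhs)
    {β' : List (Symbol T' N')} {s' : List T'} (h : Parse R' β' s') {β : List (Symbol T N)}
    (hβ : List.Forall₂ (SymbolRel ρ f) β' β) : ∃ s, Parse R β s ∧ List.Forall₂ ρ s' s := by
  induction h generalizing β with
  | nil => cases hβ; exact ⟨[], .nil, .nil⟩
  | term _ ih =>
    obtain _ | ⟨⟨hρ⟩, hβ⟩ := hβ
    obtain ⟨s, hs, hρs⟩ := ih hβ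
    exact ⟨_, .term hs, .cons hρ hρs⟩
  | nonterm hr _ _ ih₁ ih₂ =>
    obtain _ | ⟨⟨A⟩, hβ⟩ := hβ
    obtain ⟨rhs, hr, hrhs⟩ := hR _ _ hr
    obtain ⟨s, hs, hρs⟩ := ih₁ hrhs
    obtain ⟨t, ht, hρt⟩ := ih₂ hβ
    exact ⟨_, .nonterm hr hs ht, List.rel_append hρs hρt⟩

theorem Parse.exists_unrelabel
    (hR : ∀ A rhs' rhs, R A rhs → List.Forall₂ (SymbolRel ρ f) rhs' rhs → R' (f A) rhs')
    {β : List (Symbol T N)} {s : List T} (h : Parse R β s) {s' : List T'}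
    (hs : List.Forall₂ ρ s' s) : ∃ β', List.Forall₂ (SymbolRel ρ f) β' β ∧ Parse R' β' s' := by
  induction h generalizing s' with
  | nil => cases hs; exact ⟨[], .nil, .nil⟩
  | term _ ih =>
    obtain _ | ⟨hρ, hs⟩ := hs
    obtain ⟨β', hβ, h⟩ := ih hs
    exact ⟨_, .cons (.terminal hρ) hβ, .term h⟩
  | @nonterm A _ _ s t hr _ _ ih₁ ih₂ =>
    obtain ⟨s₁, t₁, hs₁, ht₁, rfl⟩ : ∃ s₁ t₁, List.Forall₂ ρ s₁ s ∧ List.Forall₂ ρ t₁ t ∧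
        s' = s₁ ++ t₁ :=
      ⟨_, _, List.forall₂_take_append _ _ _ hs, List.forall₂_drop_append _ _ _ hs,
        (List.take_append_drop _ _).symm⟩
    obtain ⟨rhs', hrhs, h₁⟩ := ih₁ hs₁
    obtain ⟨β', hβ, h₂⟩ := ih₂ ht₁
    exact ⟨_, .cons (.nonterminal A) hβ, .nonterm (hR _ _ _ hr hrhs) h₁ h₂⟩

theorem Parse.relabel_iff
    (hR : ∀ A rhs', R' (f A) rhs' ↔ ∃ rhs, R A rhs ∧ List.Forall₂ (SymbolRel ρ f) rhs' rhs)
    {A : N} {s' : List T'} :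
    Parse R' [.nonterminal (f A)] s' ↔
      ∃ s, Parse R [.nonterminal A] s ∧ List.Forall₂ ρ s' s := by
  constructor
  · exact fun h => h.exists_relabel (fun A rhs' => (hR A rhs').1) (.cons (.nonterminal A) .nil)
  · rintro ⟨s, h, hs⟩
    obtain ⟨β', hβ, h'⟩ := h.exists_unrelabel (fun A rhs' rhs hr hrhs =>
      (hR A rhs').2 ⟨rhs, hr, hrhs⟩) hs
    obtain _ | ⟨⟨_⟩, ⟨⟩⟩ := hβ
    exact h'

theorem finite_setOf_forall₂ {A B : Type} {r : A → B → Prop} (hr : ∀ b, {a | r a b}.Finite)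
    (l : List B) : {l' | List.Forall₂ r l' l}.Finite := by
  induction l with
  | nil => exact (Set.finite_singleton []).subset fun _ h => List.forall₂_nil_right_iff.1 h
  | cons b l ih =>
    refine ((hr b).image2 List.cons ih).subset ?_
    rintro _ (_ | ⟨h, hl⟩)
    exact ⟨_, h, _, hl, rfl⟩

theorem finite_relabel_rules (hρ : ∀ a, {b | ρ b a}.Finite)
    (hR : {p : N × List (Symbol T N) | R p.1 p.2}.Finite) :
    {p : N' × List (Symbol T' N') | ∃ A rhs, R A rhs ∧ p.1 = f A ∧
      List.Forall₂ (SymbolRel ρ f) p.2 rhs}.Finite := by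
  have finite_symbol : ∀ b, {a | SymbolRel ρ f a b}.Finite := by
    rintro (a | A)
    · refine ((hρ a).image Symbol.terminal).subset ?_
      rintro _ ⟨h⟩
      exact ⟨_, h, rfl⟩
    · refine (Set.finite_singleton (Symbol.nonterminal (f A))).subset ?_
      rintro _ ⟨⟩
      rfl
  refine (hR.biUnion fun p _ =>
    (finite_setOf_forall₂ finite_symbol p.2).image (Prod.mk (f p.1))).subset ?_
  rintro ⟨_, rhs'⟩ ⟨A, rhs, hr, rfl, h⟩
  exact Set.mem_biUnion (show (A, rhs) ∈ _ from hr) ⟨rhs', h, rfl⟩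

theorem isContextFree_setOf_forall₂ (hρ : ∀ a, {b | ρ b a}.Finite) {L : Language T}
    (hL : L.IsContextFree) :
    Language.IsContextFree (T := T') {s | ∃ l ∈ L, List.Forall₂ ρ s l} := by
  obtain ⟨N, R, A, hR, hL⟩ := isContextFree_iff_exists_rules.1 hL
  refine isContextFree_iff_exists_rules.2 ⟨N,
    fun A rhs' => ∃ rhs, R A rhs ∧ List.Forall₂ (SymbolRel ρ id) rhs' rhs, A, ?_, fun s => ?_⟩
  · refine (finite_relabel_rules (f := id) hρ hR).subset ?_
    rintro ⟨A, rhs'⟩ ⟨rhs, hr, h⟩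
    exact ⟨A, rhs, hr, rfl, h⟩
  · refine Iff.trans ?_ (Parse.relabel_iff (f := id) fun _ _ => Iff.rfl).symm
    exact exists_congr fun l => and_congr_left fun _ => hL l

end Relabel

theorem isContextFree_map {T T' : Type} (f : T → T') {L : Language T} (hL : L.IsContextFree) :
    (Language.map f L).IsContextFree := by
  have map_eq : Language.map f L = {s | ∃ l ∈ L, List.Forall₂ (fun b a => b = f a) s l} := by
    ext s
    refine exists_congr fun l => and_congr_right fun _ => ?_
    rw [← List.forall₂_map_right_iff, List.forall₂_eq_eq_eq, eq_comm]
  rw [map_eq]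
  exact isContextFree_setOf_forall₂ (fun a => Set.finite_singleton (f a)) hL

theorem isContextFree_mul {T : Type} {L₁ L₂ : Language T} (h₁ : L₁.IsContextFree)
    (h₂ : L₂.IsContextFree) : (L₁ * L₂).IsContextFree := by
  obtain ⟨N₁, R₁, A₁, hR₁, hL₁⟩ := isContextFree_iff_exists_rules.1 h₁
  obtain ⟨N₂, R₂, A₂, hR₂, hL₂⟩ := isContextFree_iff_exists_rules.1 h₂
  let i₁ : N₁ → Option (N₁ ⊕ N₂) := fun A => some (.inl A)
  let i₂ : N₂ → Option (N₁ ⊕ N₂) := fun A => some (.inr A)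
  let R : Option (N₁ ⊕ N₂) → List (Symbol T (Option (N₁ ⊕ N₂))) → Prop
    | none, rhs => rhs = [.nonterminal (i₁ A₁), .nonterminal (i₂ A₂)]
    | some (.inl A), rhs' => ∃ rhs, R₁ A rhs ∧ List.Forall₂ (SymbolRel Eq i₁) rhs' rhs
    | some (.inr A), rhs' => ∃ rhs, R₂ A rhs ∧ List.Forall₂ (SymbolRel Eq i₂) rhs' rhs
  have parse₁ : ∀ s, Parse R [.nonterminal (i₁ A₁)] s ↔ s ∈ L₁ := fun s => by
    rw [Parse.relabel_iff (R := R₁) (ρ := Eq) fun _ _ => Iff.rfl, List.forall₂_eq_eq_eq, hL₁]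
    exact exists_eq_right'
  have parse₂ : ∀ s, Parse R [.nonterminal (i₂ A₂)] s ↔ s ∈ L₂ := fun s => by
    rw [Parse.relabel_iff (R := R₂) (ρ := Eq) fun _ _ => Iff.rfl, List.forall₂_eq_eq_eq, hL₂]
    exact exists_eq_right'
  refine isContextFree_iff_exists_rules.2 ⟨_, R, none, ?_, fun s => ⟨?_, fun h => ?_⟩⟩
  · refine ((Set.finite_singleton (none, [.nonterminal (i₁ A₁), .nonterminal (i₂ A₂)])).union
      ((finite_relabel_rules (f := i₁) Set.finite_singleton hR₁).union
        (finite_relabel_rules (f := i₂) Set.finite_singleton hR₂))).subset ?_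
    rintro ⟨_ | A | A, rhs'⟩ h
    · exact .inl (Prod.ext rfl h)
    · obtain ⟨rhs, hr, h⟩ := h
      exact .inr (.inl ⟨A, rhs, hr, rfl, h⟩)
    · obtain ⟨rhs, hr, h⟩ := h
      exact .inr (.inr ⟨A, rhs, hr, rfl, h⟩)
  · rintro ⟨a, ha, b, hb, rfl⟩
    exact .of_rule rfl (((parse₁ a).2 ha).append ((parse₂ b).2 hb))
  · obtain ⟨_, u, v, rfl, huv, hv, rfl⟩ := Parse.nonterm_iff.1 h
    obtain ⟨a, b, ha, hb, rfl⟩ := Parse.exists_of_append (β := [_]) huv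
    obtain rfl := Parse.nil_iff.1 hv
    exact ⟨a, (parse₁ a).1 ha, b, (parse₂ b).1 hb, (List.append_nil _).symm⟩

/-- The inverse image of `L` under a partial map of letters. -/
def comap {δ T : Type} (π : δ → Option T) (L : Language T) : Language δ :=
  {s | ∃ l ∈ L, s.map π = l.map some}

section Comap

variable {δ T : Type} {π : δ → Option T} {L : Language T}

theorem isContextFree_comap [Finite δ] (π : δ → Option T) (hL : L.IsContextFree) :
    (comap π L).IsContextFree := by
  have comap_eq : comap π L = {s | ∃ l ∈ L, List.Forall₂ (fun d a => π d = some a) s l} := by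
    ext s
    refine exists_congr fun l => and_congr_right fun _ => ?_
    rw [← List.forall₂_eq_eq_eq, List.forall₂_map_left_iff, List.forall₂_map_right_iff]
  rw [comap_eq]
  exact isContextFree_setOf_forall₂ (fun a => Set.toFinite _) hL

theorem mem_comap_iff {s : List δ} {l : List T} (h : s.map π = l.map some) :
    s ∈ comap π L ↔ l ∈ L := by
  constructor
  · rintro ⟨l', hl', h'⟩
    rwa [List.map_injective_iff.2 (Option.some_injective T) (h.symm.trans h')]
  · exact fun hl => ⟨l, hl, h⟩

theorem isSome_of_mem_comap {s : List δ} (hs : s ∈ comap π L) {d : δ} (hd : d ∈ s) :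
    (π d).isSome := by
  obtain ⟨l, -, h⟩ := hs
  obtain ⟨a, -, ha⟩ := List.mem_map.1 (h ▸ List.mem_map_of_mem hd)
  rw [← ha, Option.isSome_some]

end Comap

theorem append_mem_mul_iff {T : Type} {L₁ L₂ : Language T} {P : T → Prop}
    (h₁ : ∀ s ∈ L₁, ∀ c ∈ s, P c) (h₂ : ∀ s ∈ L₂, ∀ c ∈ s, ¬ P c) {a b : List T}
    (ha : ∀ c ∈ a, P c) (hb : ∀ c ∈ b, ¬ P c) : a ++ b ∈ L₁ * L₂ ↔ a ∈ L₁ ∧ b ∈ L₂ := by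
  classical
  constructor
  · rintro ⟨a', ha', b', hb', h⟩
    have filter_append {c d : List T} (hc : ∀ x ∈ c, P x) (hd : ∀ x ∈ d, ¬ P x) :
        (c ++ d).filter P = c := by
      rw [List.filter_append, List.filter_eq_self.2 (by simpa using hc),
        List.filter_eq_nil_iff.2 (by simpa using hd), List.append_nil]
    obtain rfl : a' = a := by
      rw [← filter_append ha hb, ← h, filter_append (h₁ _ ha') (h₂ _ hb')]
    obtain rfl : b' = b := List.append_cancel_left h
    exact ⟨ha', hb'⟩
  · rintro ⟨ha', hb'⟩
    exact Language.append_mem_mul ha' hb'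

/-! ### Mirror-image words -/

/-- The words `p rᴿ`, over disjoint copies of the two alphabets, in which `r` belongs to `L` and
`p` and `r` carry the same keys, the keys being read off the letters by `f` and `g`.
This is the kind of comparison of two blocks that a pushdown automaton can carry out. -/
def mirror {A B κ : Type} (L : Language B) (f : A → Option κ) (g : B → Option κ) :
    Language (A ⊕ B) :=
  {s | ∃ p : List A, ∃ r ∈ L, p.filterMap f = r.filterMap g ∧
    s = p.map .inl ++ (r.map .inr).reverse}

section Mirror

variable {A B κ : Type} {L : Language B} {f : A → Option κ} {g : B → Option κ}

theorem filterMap_eq_induction {motive : List A → List B → Prop} (nil : motive [] [])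
    (cons : ∀ (a : Option A) (b : Option B) p r, a.bind f = b.bind g → motive p r →
      motive (a.toList ++ p) (b.toList ++ r)) (p : List A) (r : List B)
    (h : p.filterMap f = r.filterMap g) : motive p r := by
  induction p generalizing r with
  | nil =>
    induction r with
    | nil => exact nil
    | cons b r ih =>
      obtain ⟨hb, hr⟩ := List.forall_mem_cons.1 (List.filterMap_eq_nil_iff.1 h.symm)
      exact cons none (some b) [] r hb.symm (ih (List.filterMap_eq_nil_iff.2 hr).symm)
  | cons a p ihp =>
    cases ha : f a with
    | none =>
      exact cons (some a) none p r ha (ihp r ((List.filterMap_cons_none ha).symm.trans h))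
    | some k =>
      induction r with
      | nil => rw [List.filterMap_cons_some ha] at h; cases h
      | cons b r ihr =>
        cases hb : g b with
        | none =>
          exact cons none (some b) (a :: p) r hb.symm (ihr (h.trans (List.filterMap_cons_none hb)))
        | some k' =>
          rw [List.filterMap_cons_some ha, List.filterMap_cons_some hb] at h
          obtain ⟨rfl, hpr⟩ := List.cons.inj h
          exact cons (some a) (some b) p r (ha.trans hb.symm) (ihp r hpr)

theorem mem_mirror_iff {p : List A} {r : List B} :
    p.map .inl ++ (r.map .inr).reverse ∈ mirror L f g ↔
      r ∈ L ∧ p.filterMap f = r.filterMap g := by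
  constructor
  · rintro ⟨p', r', hr', hk, h⟩
    have left_part (p : List A) (r : List B) :
        (p.map .inl ++ (r.map .inr).reverse : List (A ⊕ B)).filterMap Sum.getLeft? = p := by
      simp [List.filterMap_map, Function.comp_def]
    have right_part (p : List A) (r : List B) :
        (p.map .inl ++ (r.map .inr).reverse : List (A ⊕ B)).filterMap Sum.getRight? =
          r.reverse := by
      simp [List.filterMap_map, Function.comp_def]
    obtain rfl : p = p' := by rw [← left_part p r, h, left_part]
    obtain rfl : r = r' := List.reverse_injective <| by rw [← right_part p r, h, right_part]
    exact ⟨hr', hk⟩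
  · exact fun ⟨hr, hk⟩ => ⟨p, r, hr, hk, rfl⟩

/-- The rules for `mirror D.accepts f g`: the nonterminals are the states of `D`, and the word is
produced from the outside inwards. -/
def MirrorRule {σ : Type} (D : DFA B σ) (f : A → Option κ) (g : B → Option κ) (q : σ)
    (rhs : List (Symbol (A ⊕ B) σ)) : Prop :=
  q ∈ D.accept ∧ rhs = [] ∨ ∃ (a : Option A) (b : Option B), a.bind f = b.bind g ∧
    rhs = (a.toList.map fun a => .terminal (.inl a)) ++
      .nonterminal (D.evalFrom q b.toList) :: b.toList.map fun b => .terminal (.inr b)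

theorem finite_mirrorRule [Finite A] [Finite B] {σ : Type} [Finite σ] (D : DFA B σ)
    (f : A → Option κ) (g : B → Option κ) :
    {p : σ × List (Symbol (A ⊕ B) σ) | MirrorRule D f g p.1 p.2}.Finite := by
  refine ((Set.finite_range fun q : σ => (q, [])).union
    (Set.finite_range fun x : σ × Option A × Option B =>
      (x.1, (x.2.1.toList.map fun a => .terminal (.inl a)) ++
        .nonterminal (D.evalFrom x.1 x.2.2.toList) ::
          x.2.2.toList.map fun b => .terminal (.inr b)))).subset ?_
  rintro ⟨q, rhs⟩ (⟨-, h⟩ | ⟨a, b, -, h⟩)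
  · exact .inl ⟨q, Prod.ext rfl h.symm⟩
  · exact .inr ⟨(q, a, b), Prod.ext rfl h.symm⟩

theorem mem_mirror_of_parse {σ : Type} {D : DFA B σ} {q : σ} {s : List (A ⊕ B)}
    (h : Parse (MirrorRule D f g) [.nonterminal q] s) : s ∈ mirror (D.acceptsFrom q) f g := by
  have sound : ∀ q rhs s, MirrorRule D f g q rhs →
      Interprets (fun q s => s ∈ mirror (D.acceptsFrom q) f g) rhs s →
      s ∈ mirror (D.acceptsFrom q) f g := by
    rintro q _ s (⟨hq, rfl⟩ | ⟨a, b, hab, rfl⟩) hs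
    · exact ⟨[], [], hq, rfl, hs⟩
    · obtain ⟨_, ⟨p, r, hr, hk, rfl⟩, rfl⟩ :
          ∃ u ∈ mirror (D.acceptsFrom (D.evalFrom q b.toList)) f g, s =
            a.toList.map .inl ++ u ++ b.toList.map .inr := by
        cases a <;> cases b <;> simpa [Interprets, and_comm] using hs
      refine ⟨a.toList ++ p, b.toList ++ r, ?_, ?_, ?_⟩
      · rwa [DFA.mem_acceptsFrom, DFA.evalFrom_of_append]
      · cases a <;> cases b <;> simp_all [List.filterMap_cons]
      · cases b <;> simp
  obtain ⟨u, _, hu, rfl, rfl⟩ := h.interprets sound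
  rwa [List.append_nil]

theorem parse_of_filterMap_eq {σ : Type} {D : DFA B σ} {p : List A} {r : List B}
    (h : p.filterMap f = r.filterMap g) {q : σ} (hr : r ∈ D.acceptsFrom q) :
    Parse (MirrorRule D f g) [.nonterminal q] (p.map .inl ++ (r.map .inr).reverse) := by
  refine filterMap_eq_induction (motive := fun p r => ∀ q, r ∈ D.acceptsFrom q →
    Parse (MirrorRule D f g) [.nonterminal q] (p.map .inl ++ (r.map .inr).reverse))
    (fun q hq => ?_) (fun a b p r hab ih q hr => ?_) p r h q hr
  · exact .of_rule (.inl ⟨hq, rfl⟩) .nil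
  · rw [DFA.mem_acceptsFrom, DFA.evalFrom_of_append] at hr
    refine .of_rule (.inr ⟨a, b, hab, rfl⟩) ?_
    have inside := (ih _ hr).append (Parse.map_terminal _ (b.toList.map .inr))
    have outside := (Parse.map_terminal (MirrorRule D f g) (a.toList.map .inl)).append inside
    cases b <;> simpa [Function.comp_def] using outside

theorem isContextFree_mirror [Finite A] [Finite B] (hL : L.IsRegular) (f : A → Option κ)
    (g : B → Option κ) : (mirror L f g).IsContextFree := by
  obtain ⟨σ, _, D, rfl⟩ := hL
  refine isContextFree_iff_exists_rules.2
    ⟨σ, MirrorRule D f g, D.start, finite_mirrorRule D f g, fun s => ⟨?_, mem_mirror_of_parse⟩⟩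
  rintro ⟨p, r, hr, hk, rfl⟩
  exact parse_of_filterMap_eq hk hr

end Mirror

theorem isContextFree_of_isRegular {B : Type} [Finite B] {L : Language B} (hL : L.IsRegular) :
    L.IsContextFree := by
  have reverse_eq : comap (fun b => some (.inr b))
      (mirror L (fun _ : Empty => (none : Option Unit)) fun _ => none) = L.reverse := by
    ext s
    rw [mem_comap_iff (l := ([] : List Empty).map .inl ++ (s.reverse.map .inr).reverse)
      (by simp), mem_mirror_iff]
    simp
  refine .of_reverse ?_
  rw [← reverse_eq]
  exact isContextFree_comap _ (isContextFree_mirror hL _ _)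

/-! ### Two-track strings -/

section Track

variable {α γ : Type}

/-- All two-track strings over the alphabets `α` and `γ`. -/
def trackWords (α γ : Type) : Language (Option α × Option γ) := {l | ∃ x y, l = track x y}

theorem filterMap_fst_track (x : List α) (y : List γ) : (track x y).filterMap Prod.fst = x := by
  induction x generalizing y with
  | nil => simp [track, List.filterMap_map]
  | cons a x ih =>
    cases y with
    | nil => simp [track, List.filterMap_map]
    | cons b y => simpa [track] using ih y

theorem filterMap_snd_track (x : List α) (y : List γ) : (track x y).filterMap Prod.snd = y := by
  induction x generalizing y with
  | nil => simp [track, List.filterMap_map]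
  | cons a x ih =>
    cases y with
    | nil => simp [track, List.filterMap_map]
    | cons b y => simpa [track] using ih y

theorem length_track_le (x : List α) (y : List γ) :
    (track x y).length ≤ x.length + y.length := by
  induction x generalizing y with
  | nil => simp [track]
  | cons a x ih =>
    cases y with
    | nil => simp [track]
    | cons b y =>
      have := ih y
      simp only [track, List.zipWithAll_cons_cons, List.length_cons] at this ⊢
      omega

theorem mem_trackWords_iff {l : List (Option α × Option γ)} :
    l ∈ trackWords α γ ↔ (∀ c ∈ l, c ≠ (none, none)) ∧
      l.Pairwise fun c d => (c.1 = none → d.1 = none) ∧ (c.2 = none → d.2 = none) := by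
  constructor
  · rintro ⟨x, y, rfl⟩
    induction x generalizing y with
    | nil => simp [track, List.pairwise_map, List.pairwise_of_forall]
    | cons a x ih =>
      cases y with
      | nil => simp [track, List.pairwise_map, List.pairwise_of_forall]
      | cons b y => simpa [track] using ih y
  · rintro ⟨hne, h⟩
    induction l with
    | nil => exact ⟨[], [], rfl⟩
    | cons c l ih =>
      obtain ⟨hc, hl⟩ := List.pairwise_cons.1 h
      obtain ⟨x, y, rfl⟩ := ih (fun d hd => hne d (List.mem_cons_of_mem c hd)) hl
      have x_nil (hc₁ : c.1 = none) : x = [] := by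
        rw [← filterMap_fst_track x y]
        exact List.filterMap_eq_nil_iff.2 fun d hd => (hc d hd).1 hc₁
      have y_nil (hc₂ : c.2 = none) : y = [] := by
        rw [← filterMap_snd_track x y]
        exact List.filterMap_eq_nil_iff.2 fun d hd => (hc d hd).2 hc₂
      obtain ⟨_ | a, _ | b⟩ := c
      · exact absurd rfl (hne _ List.mem_cons_self)
      · exact ⟨[], b :: y, by simp [x_nil rfl, track]⟩
      · exact ⟨a :: x, [], by simp [y_nil rfl, track]⟩
      · exact ⟨a :: x, b :: y, rfl⟩

theorem isRegular_trackWords [Finite α] [Finite γ] : (trackWords α γ).IsRegular := by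
  rw [show trackWords α γ = {l | _} from Set.ext fun _ => mem_trackWords_iff]
  exact isRegular_setOf_forall_and_pairwise _ _

end Track

/-! ### Computation histories -/

instance {α : Type} [Finite α] : Finite (TapeSymbol α) :=
  Finite.of_surjective (fun o : Option (Option α) => match o with
    | none => TapeSymbol.left
    | some none => TapeSymbol.right
    | some (some a) => TapeSymbol.sym a) fun s => match s with
    | .left => ⟨none, rfl⟩
    | .right => ⟨some none, rfl⟩
    | .sym a => ⟨some (some a), rfl⟩

/-- The input tape holding `x` between the endmarkers. -/
def tape {α : Type} (x : List α) : List (TapeSymbol α) :=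
  TapeSymbol.left :: (x.map TapeSymbol.sym ++ [TapeSymbol.right])

namespace NPDA

variable {α ω : Type} {M : NPDA α ω}

theorem Run.append {c c' c'' : M.Config} {l l' : List ω} (h : M.Run c l c')
    (h' : M.Run c' l' c'') : M.Run c (l ++ l') c'' := by
  induction h with
  | nil => exact h'
  | cons hs _ ih => exact .cons hs (ih h')

/-- `M.Pops p v q t`: from state `p`, a computation with letters `t` (the tape symbol read, if any,
and the emission of each move) removes `v` from the stack and ends in state `q`.  The accepting
states may discard stack symbols, since acceptance does not require an empty stack. -/
inductive Pops (M : NPDA α ω) :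
    M.State → List M.Stack → M.State → List (Option (TapeSymbol α) × ω) → Prop
  | nil (p : M.State) : Pops M p [] p []
  | step {p p' r q : M.State} {s : Option (TapeSymbol α)} {z : M.Stack} {β v : List M.Stack}
      {w : ω} {t t' : List (Option (TapeSymbol α) × ω)} :
      p ∉ M.halt → (p', β, w) ∈ M.trans p s z → Pops M p' β r t → Pops M r v q t' →
      Pops M p (z :: v) q ((s, w) :: (t ++ t'))
  | discard {p q : M.State} {z : M.Stack} {v : List M.Stack}
      {t : List (Option (TapeSymbol α) × ω)} :
      p ∈ M.acc → Pops M p v q t → Pops M p (z :: v) q t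

namespace Pops

variable {p q r : M.State} {v v' : List M.Stack} {t t' : List (Option (TapeSymbol α) × ω)}

theorem of_acc (h : M.Pops p v q t) (hp : p ∈ M.acc) : q = p ∧ t = [] := by
  induction h with
  | nil => exact ⟨rfl, rfl⟩
  | step h => exact absurd (Or.inl hp) h
  | discard _ _ ih => exact ih hp

theorem discard_all (hq : q ∈ M.acc) (v : List M.Stack) : M.Pops q v q [] := by
  induction v with
  | nil => exact .nil q
  | cons z v ih => exact .discard hq ih

theorem append (h : M.Pops p v r t) (h' : M.Pops r v' q t') :
    M.Pops p (v ++ v') q (t ++ t') := by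
  induction h with
  | nil => exact h'
  | step hp hm h₁ _ _ ih =>
    simpa only [List.cons_append, List.append_assoc] using Pops.step hp hm h₁ (ih h')
  | discard hp _ ih => exact .discard hp (ih h')

theorem append_split (h : M.Pops p (v ++ v') q t) :
    ∃ r t₁ t₂, M.Pops p v r t₁ ∧ M.Pops r v' q t₂ ∧ t = t₁ ++ t₂ := by
  generalize hu : v ++ v' = u at h
  induction h generalizing v with
  | nil p =>
    obtain ⟨rfl, rfl⟩ := List.append_eq_nil_iff.1 hu
    exact ⟨p, [], [], .nil p, .nil p, rfl⟩
  | @step p _ _ _ _ _ _ _ _ _ _ hp hm h₁ h₂ _ ih =>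
    cases v with
    | nil => exact ⟨p, [], _, .nil p, by cases hu; exact .step hp hm h₁ h₂, rfl⟩
    | cons z v =>
      cases hu
      obtain ⟨r, t₁, t₂, h₃, h₄, rfl⟩ := ih rfl
      exact ⟨r, _, t₂, .step hp hm h₁ h₃, h₄, by rw [List.cons_append, List.append_assoc]⟩
  | @discard p _ _ _ _ hp h ih =>
    cases v with
    | nil => exact ⟨p, [], _, .nil p, by cases hu; exact .discard hp h, rfl⟩
    | cons z v =>
      cases hu
      obtain ⟨r, t₁, t₂, h₃, h₄, rfl⟩ := ih rfl
      exact ⟨r, _, t₂, .discard hp h₃, h₄, rfl⟩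

theorem exists_run (h : M.Pops p v q t) (u : List (TapeSymbol α)) (v₀ : List M.Stack) :
    ∃ v', M.Run ⟨p, t.filterMap Prod.fst ++ u, v ++ v₀⟩ (t.map Prod.snd) ⟨q, u, v'⟩ ∧
      (v' = v₀ ∨ q ∈ M.acc) := by
  induction h generalizing u v₀ with
  | nil p => exact ⟨v₀, .nil _, .inl rfl⟩
  | @step p p' r q s z β v w t t' hp hm h₁ h₂ ih₁ ih₂ =>
    obtain ⟨v₁, hr₁, hv₁⟩ := ih₁ (t'.filterMap Prod.fst ++ u) (v ++ v₀)
    have first_step : M.Step ⟨p, ((s, w) :: (t ++ t')).filterMap Prod.fst ++ u, z :: v ++ v₀⟩ w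
        ⟨p', t.filterMap Prod.fst ++ (t'.filterMap Prod.fst ++ u), β ++ (v ++ v₀)⟩ := by
      rw [← List.append_assoc, ← List.filterMap_append]
      cases s with
      | none => exact .silent hp hm
      | some s => exact .read hp hm
    rw [List.map_cons, List.map_append]
    rcases hv₁ with rfl | hr
    · obtain ⟨v₂, hr₂, hv₂⟩ := ih₂ u v₀
      exact ⟨v₂, .cons first_step (hr₁.append hr₂), hv₂⟩
    · obtain ⟨rfl, rfl⟩ := h₂.of_acc hr
      exact ⟨v₁, .cons first_step (by simpa using hr₁), .inr hr⟩
  | discard hp h ih =>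
    obtain ⟨rfl, rfl⟩ := h.of_acc hp
    exact ⟨_, .nil _, .inr hp⟩

end Pops

theorem Run.exists_pops {c c' : M.Config} {l : List ω} (h : M.Run c l c') (hc : c'.state ∈ M.acc) :
    ∃ t, M.Pops c.state c.stack c'.state t ∧ l = t.map Prod.snd ∧
      c.input = t.filterMap Prod.fst ++ c'.input := by
  induction h with
  | nil c => exact ⟨[], Pops.discard_all hc _, rfl, rfl⟩
  | cons hs _ ih =>
    obtain ⟨t, ht, rfl, hu⟩ := ih hc
    cases hs with
    | read hq hm =>
      obtain ⟨r, t₁, t₂, h₁, h₂, rfl⟩ := ht.append_split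
      exact ⟨_, .step hq hm h₁ h₂, rfl, congrArg _ hu⟩
    | silent hq hm =>
      obtain ⟨r, t₁, t₂, h₁, h₂, rfl⟩ := ht.append_split
      exact ⟨_, .step hq hm h₁ h₂, rfl, hu⟩

/-- The letters of the accepting computations, on arbitrary inputs. -/
def traces (M : NPDA α ω) : Language (Option (TapeSymbol α) × ω) :=
  {t | ∃ q ∈ M.acc, M.Pops M.start [M.bottom] q t}

/-- Sentential forms in the letters and the nonterminals of the triple construction: `(p, z, q)`
derives the words `t` with `M.Pops p [z] q t`, and `none` derives `M.traces`. -/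
abbrev TripleForm (M : NPDA α ω) : Type :=
  List (Symbol (Option (TapeSymbol α) × ω) (Option (M.State × M.Stack × M.State)))

/-- The sentential forms `(p, z₁, r₁) (r₁, z₂, r₂) ⋯ (rₙ₋₁, zₙ, q)` for a stack `z₁ ⋯ zₙ`. -/
def popChains (M : NPDA α ω) : List M.Stack → M.State → M.State → Set M.TripleForm
  | [], p, q => {l | p = q ∧ l = []}
  | z :: v, p, q => {l | ∃ r, ∃ l' ∈ popChains M v r q, l = .nonterminal (some (p, z, r)) :: l'}

/-- The rules of the triple construction. -/
def TripleRule (M : NPDA α ω) : Option (M.State × M.Stack × M.State) → M.TripleForm → Prop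
  | none, rhs => ∃ q ∈ M.acc, rhs = [.nonterminal (some (M.start, M.bottom, q))]
  | some (p, z, q), rhs => p ∈ M.acc ∧ p = q ∧ rhs = [] ∨
      p ∉ M.halt ∧ ∃ s p' β w, (p', β, w) ∈ M.trans p s z ∧
        ∃ l ∈ M.popChains β p' q, rhs = .terminal (s, w) :: l

theorem finite_popChains (M : NPDA α ω) (v : List M.Stack) (p q : M.State) :
    (M.popChains v p q).Finite := by
  have := M.finite_state
  induction v generalizing p with
  | nil => exact (Set.finite_singleton []).subset fun _ h => h.2
  | cons z v ih =>
    refine (Set.finite_iUnion fun r =>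
      (ih r).image (.nonterminal (some (p, z, r)) :: ·)).subset ?_
    rintro _ ⟨r, l, hl, rfl⟩
    exact Set.mem_iUnion.2 ⟨r, l, hl, rfl⟩

theorem finite_tripleRule [Finite α] (M : NPDA α ω) :
    {p : Option (M.State × M.Stack × M.State) × M.TripleForm | M.TripleRule p.1 p.2}.Finite := by
  have := M.finite_state
  have := M.finite_stack
  have finite_rhs : ∀ A, {rhs | M.TripleRule A rhs}.Finite := by
    rintro (_ | ⟨p, z, q⟩)
    · refine (Set.finite_range fun q => [.nonterminal (some (M.start, M.bottom, q))]).subset ?_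
      rintro _ ⟨q, -, rfl⟩
      exact ⟨q, rfl⟩
    · refine ((Set.finite_singleton []).union (Set.finite_iUnion fun s =>
        (M.finite_trans p s z).biUnion fun m _ =>
          (M.finite_popChains m.2.1 m.1 q).image (.terminal (s, m.2.2) :: ·))).subset ?_
      rintro _ (⟨-, -, rfl⟩ | ⟨-, s, p', β, w, hm, l, hl, rfl⟩)
      · exact .inl rfl
      · exact .inr (Set.mem_iUnion.2 ⟨s, Set.mem_biUnion hm ⟨l, hl, rfl⟩⟩)
  refine (Set.finite_iUnion fun A => (finite_rhs A).image (Prod.mk A)).subset ?_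
  exact fun ⟨A, rhs⟩ h => Set.mem_iUnion.2 ⟨A, rhs, h, rfl⟩

theorem Pops.exists_parse {p q : M.State} {v : List M.Stack}
    {t : List (Option (TapeSymbol α) × ω)} (h : M.Pops p v q t) :
    ∃ l ∈ M.popChains v p q, Parse M.TripleRule l t := by
  induction h with
  | nil p => exact ⟨[], ⟨rfl, rfl⟩, .nil⟩
  | step hp hm _ _ ih₁ ih₂ =>
    obtain ⟨l₁, hl₁, h₁⟩ := ih₁
    obtain ⟨l₂, hl₂, h₂⟩ := ih₂
    exact ⟨_, ⟨_, l₂, hl₂, rfl⟩,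
      .nonterm (.inr ⟨hp, _, _, _, _, hm, l₁, hl₁, rfl⟩) (.term h₁) h₂⟩
  | discard hp _ ih =>
    obtain ⟨l, hl, h⟩ := ih
    exact ⟨_, ⟨_, l, hl, rfl⟩, .nonterm (.inl ⟨hp, rfl, rfl⟩) .nil h⟩

/-- The words that the nonterminals of the triple construction stand for. -/
def TripleMeaning (M : NPDA α ω) :
    Option (M.State × M.Stack × M.State) → List (Option (TapeSymbol α) × ω) → Prop
  | none, t => t ∈ M.traces
  | some (p, z, q), t => M.Pops p [z] q t

theorem pops_of_interprets {v : List M.Stack} {p q : M.State} {l : M.TripleForm}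
    (hl : l ∈ M.popChains v p q) {t : List (Option (TapeSymbol α) × ω)}
    (h : Interprets M.TripleMeaning l t) : M.Pops p v q t := by
  induction v generalizing p l t with
  | nil =>
    obtain ⟨rfl, rfl⟩ := hl
    obtain rfl : t = [] := h
    exact .nil p
  | cons z v ih =>
    obtain ⟨r, l, hl, rfl⟩ := hl
    obtain ⟨t₁, t₂, h₁, h₂, rfl⟩ := h
    exact Pops.append (v := [z]) h₁ (ih hl h₂)

theorem tripleMeaning_of_interprets {A : Option (M.State × M.Stack × M.State)}
    {rhs : M.TripleForm} {t : List (Option (TapeSymbol α) × ω)} (hr : M.TripleRule A rhs)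
    (h : Interprets M.TripleMeaning rhs t) : M.TripleMeaning A t := by
  obtain _ | ⟨p, z, q⟩ := A
  · obtain ⟨q, hq, rfl⟩ := hr
    obtain ⟨t, _, ht, rfl, rfl⟩ := h
    exact ⟨q, hq, t.append_nil.symm ▸ ht⟩
  · obtain ⟨hp, rfl, rfl⟩ | ⟨hp, s, p', β, w, hm, l, hl, rfl⟩ := hr
    · obtain rfl : t = [] := h
      exact .discard hp (.nil p)
    · obtain ⟨t, rfl, ht⟩ := h
      simpa only [TripleMeaning, List.append_nil] using
        Pops.step hp hm (pops_of_interprets hl ht) (.nil q)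

theorem isContextFree_traces [Finite α] (M : NPDA α ω) : M.traces.IsContextFree := by
  refine isContextFree_iff_exists_rules.2
    ⟨_, M.TripleRule, none, M.finite_tripleRule, fun t => ⟨?_, fun h => ?_⟩⟩
  · rintro ⟨q, hq, ht⟩
    obtain ⟨_, ⟨_, _, ⟨rfl, rfl⟩, rfl⟩, h⟩ := ht.exists_parse
    exact .of_rule ⟨_, hq, rfl⟩ h
  · obtain ⟨t, _, ht, rfl, rfl⟩ :=
      h.interprets (I := M.TripleMeaning) fun _ _ _ => tripleMeaning_of_interprets
    exact t.append_nil.symm ▸ ht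

section Histories

variable {γ : Type}

/-- Lists of unread tape symbols, as letters of a computation history. -/
def unread (α γ : Type) : Language (Option (TapeSymbol α) × Option γ) :=
  {r | ∀ d ∈ r, d.1.isSome ∧ d.2 = none}

theorem isRegular_unread [Finite α] [Finite γ] : (unread α γ).IsRegular := by
  rw [show unread α γ = {r | (∀ d ∈ r, d.1.isSome ∧ d.2 = none) ∧ r.Pairwise fun _ _ => True} from
    Set.ext fun r => (and_iff_left (List.pairwise_of_forall fun _ _ => trivial)).symm]
  exact isRegular_setOf_forall_and_pairwise _ _

/-- The computation histories of `M`: the letters of an accepting computation, followed by the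
unread tape symbols, so that the whole input tape can be read off a history. -/
def histories (M : NPDA α (Option γ)) : Language (Option (TapeSymbol α) × Option γ) :=
  M.traces * unread α γ

theorem isContextFree_histories [Finite α] [Finite γ] (M : NPDA α (Option γ)) :
    M.histories.IsContextFree :=
  isContextFree_mul M.isContextFree_traces (isContextFree_of_isRegular isRegular_unread)

theorem mem_outcomes_of_history {M : NPDA α (Option γ)} {x : List α}
    {w : List (Option (TapeSymbol α) × Option γ)} (hw : w ∈ M.histories)
    (hx : w.filterMap Prod.fst = tape x) : w.filterMap Prod.snd ∈ M.outcomes x := by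
  obtain ⟨t, ⟨q, hq, ht⟩, r, hr, rfl⟩ := hw
  obtain ⟨v', hrun, -⟩ := ht.exists_run (r.filterMap Prod.fst) []
  rw [← List.filterMap_append, hx] at hrun
  refine ⟨t.map Prod.snd, ⟨_, hrun, hq⟩, ?_⟩
  rw [List.filterMap_append, List.filterMap_eq_nil_iff.2 fun d hd => (hr d hd).2,
    List.append_nil, List.reduceOption, List.filterMap_map, Function.id_comp]

theorem exists_history {M : NPDA α (Option γ)} (hM : M.Terminates) :
    ∃ a b : ℕ, ∀ x, ∀ y ∈ M.outcomes x, ∃ w ∈ M.histories, w.filterMap Prod.fst = tape x ∧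
      w.filterMap Prod.snd = y ∧ w.length ≤ a * x.length + b := by
  obtain ⟨a, b, hab⟩ := hM
  refine ⟨a + 1, b + 2, ?_⟩
  rintro x _ ⟨l, ⟨c, hrun, hc⟩, rfl⟩
  obtain ⟨t, ht, rfl, hu : tape x = t.filterMap Prod.fst ++ c.input⟩ := hrun.exists_pops hc
  have unread_fst : (c.input.map fun s => (some s, (none : Option γ))).filterMap Prod.fst =
      c.input := by
    rw [List.filterMap_map]
    exact List.filterMap_some
  have unread_snd : (c.input.map fun s => (some s, (none : Option γ))).filterMap Prod.snd = [] :=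
    List.filterMap_eq_nil_iff.2 (by simp)
  refine ⟨t ++ c.input.map fun s => (some s, none), ⟨t, ⟨_, hc, ht⟩, _, ?_, rfl⟩, ?_, ?_, ?_⟩
  · exact List.forall_mem_map.2 fun s _ => ⟨rfl, rfl⟩
  · rw [List.filterMap_append, unread_fst, hu]
  · rw [List.filterMap_append, unread_snd, List.append_nil, List.reduceOption,
      List.filterMap_map, Function.id_comp]
  · have run_length := (hab _ _ _ hrun).1
    have tape_length := congrArg List.length hu
    simp only [tape, List.length_cons, List.length_append, List.length_map, List.length_nil]
      at run_length tape_length ⊢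
    linarith

end Histories

end NPDA

/-! ### The guessing npda -/

/-- The query alphabet of the guessing npda: a guessed letter along with the tape symbol that is
read with it, if any, or a repeated guess. -/
abbrev QueryLetter (α Δ : Type) : Type := (Option (TapeSymbol α) × Δ) ⊕ Δ

/-- The query in which the guesses of `t` are followed by their repetition in reverse order. -/
def query {α Δ : Type} (t : List (Option (TapeSymbol α) × Δ)) : List (QueryLetter α Δ) :=
  t.map .inl ++ (t.map Prod.snd).reverse.map .inr

/-- The states of the guessing npda: guessing, with a remaining budget of guesses before the next
tape symbol is read, popping the stack, and accepting. -/
inductive GuessState (K : ℕ) : Type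
  | read : Fin (K + 1) → GuessState K
  | pop : GuessState K
  | accept : GuessState K

instance (K : ℕ) : Finite (GuessState K) :=
  Finite.of_surjective (fun o : Option (Option (Fin (K + 1))) => match o with
    | none => GuessState.accept
    | some none => GuessState.pop
    | some (some k) => GuessState.read k) fun
    | .accept => ⟨none, rfl⟩
    | .pop => ⟨some none, rfl⟩
    | .read k => ⟨some (some k), rfl⟩

/-- The transitions of the guessing npda. -/
inductive GuessTrans (α Δ : Type) (K : ℕ) : GuessState K → Option (TapeSymbol α) → Option Δ →
    GuessState K × List (Option Δ) × (Option (Fin 2) × Option (QueryLetter α Δ)) → Prop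
  | guess {k k' : Fin (K + 1)} (h : (k : ℕ) = k' + 1) (d : Δ) (z : Option Δ) :
      GuessTrans α Δ K (.read k) none z (.read k', [some d, z], none, some (.inl (none, d)))
  | symbol (k : Fin (K + 1)) {s : TapeSymbol α} (hs : s ≠ .right) (d : Δ) (z : Option Δ) :
      GuessTrans α Δ K (.read k) (some s) z
        (.read (Fin.last K), [some d, z], none, some (.inl (some s, d)))
  | turn (k : Fin (K + 1)) (d : Δ) (z : Option Δ) :
      GuessTrans α Δ K (.read k) (some .right) z
        (.pop, [some d, z], none, some (.inl (some .right, d)))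
  | pop (d : Δ) : GuessTrans α Δ K .pop none (some d) (.pop, [], none, some (.inr d))
  | finish : GuessTrans α Δ K .pop none none (.accept, [none], some 1, none)

/-- The npda that guesses and pushes a letter with each tape symbol, and up to `K` further ones
before it, and finally repeats its guesses while popping them.  The bottom marker is `none`. -/
def guesser (α Δ : Type) [Finite α] [Finite Δ] (K : ℕ) :
    NPDA α (Option (Fin 2) × Option (QueryLetter α Δ)) where
  State := GuessState K
  Stack := Option Δ
  finite_state := inferInstance
  finite_stack := inferInstance
  start := .read (Fin.last K)
  bottom := none
  acc := {.accept}
  rej := ∅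
  disjoint_acc_rej := Set.disjoint_empty _
  trans q s z := {m | GuessTrans α Δ K q s z m}
  finite_trans q s z := by
    refine (Set.finite_univ.prod ((List.finite_length_le (Option Δ) 2).prod
      Set.finite_univ)).subset ?_
    rintro ⟨q', β, w⟩ h
    refine ⟨trivial, ?_, trivial⟩
    cases h <;> simp

/-- A configuration of the guessing npda: its state, the unread tape symbols, and the guesses on
the stack, without the bottom marker. -/
structure GuessConfig (α Δ : Type) (K : ℕ) : Type where
  state : GuessState K
  input : List (TapeSymbol α)
  guesses : List Δ

namespace GuessConfig

variable {α Δ : Type} {K : ℕ}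

/-- The moves of the guessing npda. -/
inductive Move : GuessConfig α Δ K → Option (Fin 2) × Option (QueryLetter α Δ) →
    GuessConfig α Δ K → Prop
  | guess {k k' : Fin (K + 1)} (h : (k : ℕ) = k' + 1) (d : Δ) (u : List (TapeSymbol α))
      (P : List Δ) :
      Move ⟨.read k, u, P⟩ (none, some (.inl (none, d))) ⟨.read k', u, d :: P⟩
  | symbol (k : Fin (K + 1)) {s : TapeSymbol α} (hs : s ≠ .right) (d : Δ)
      (u : List (TapeSymbol α)) (P : List Δ) :
      Move ⟨.read k, s :: u, P⟩ (none, some (.inl (some s, d))) ⟨.read (Fin.last K), u, d :: P⟩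
  | turn (k : Fin (K + 1)) (d : Δ) (u : List (TapeSymbol α)) (P : List Δ) :
      Move ⟨.read k, .right :: u, P⟩ (none, some (.inl (some .right, d))) ⟨.pop, u, d :: P⟩
  | pop (d : Δ) (u : List (TapeSymbol α)) (P : List Δ) :
      Move ⟨.pop, u, d :: P⟩ (none, some (.inr d)) ⟨.pop, u, P⟩
  | finish (u : List (TapeSymbol α)) : Move ⟨.pop, u, []⟩ (some 1, none) ⟨.accept, u, []⟩

/-- A bound for the number of remaining moves. -/
def potential : GuessConfig α Δ K → ℕ
  | ⟨.read k, u, P⟩ => 2 * k + P.length + (2 * K + 3) * u.length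
  | ⟨.pop, _, P⟩ => P.length + 1
  | ⟨.accept, _, _⟩ => 0

/-- The invariant that keeps the guessing npda from getting stuck. -/
def Live (c : GuessConfig α Δ K) : Prop := ∀ k, c.state = .read k → TapeSymbol.right ∈ c.input

theorem Move.potential_lt {c c' : GuessConfig α Δ K}
    {w : Option (Fin 2) × Option (QueryLetter α Δ)} (h : Move c w c') :
    c'.potential < c.potential := by
  cases h <;> simp only [potential, List.length_cons, List.length_nil, Fin.val_last, mul_add] <;>
    omega

theorem Move.live {c c' : GuessConfig α Δ K} {w : Option (Fin 2) × Option (QueryLetter α Δ)}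
    (h : Move c w c') (hc : c.Live) : c'.Live := by
  cases h with
  | guess => exact fun _ _ => hc _ rfl
  | symbol _ hs => exact fun _ _ => (List.mem_cons.1 (hc _ rfl)).resolve_left hs.symm
  | turn | pop | finish => exact fun _ h => nomatch h

theorem Live.exists_move [Nonempty Δ] {c : GuessConfig α Δ K} (hc : c.Live)
    (hstate : c.state ≠ .accept) : ∃ w c', Move c w c' := by
  obtain ⟨d⟩ := ‹Nonempty Δ›
  obtain ⟨_ | _ | _, u, P⟩ := c
  · obtain _ | ⟨s, u⟩ := u
    · cases hc _ rfl
    · by_cases hs : s = .right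
      · subst hs
        exact ⟨_, _, .turn _ d u P⟩
      · exact ⟨_, _, .symbol _ hs d u P⟩
  · cases P with
    | nil => exact ⟨_, _, .finish u⟩
    | cons d P => exact ⟨_, _, .pop d u P⟩
  · exact absurd rfl hstate

variable [Finite α] [Finite Δ]

/-- The configuration as one of the npda, whose stack has the bottom marker `none`. -/
def toConfig (c : GuessConfig α Δ K) : (guesser α Δ K).Config :=
  ⟨c.state, c.input, c.guesses.map some ++ [none]⟩

theorem mem_halt_iff {q : GuessState K} : q ∈ (guesser α Δ K).halt ↔ q = .accept :=
  ⟨fun h => h.resolve_right id, .inl⟩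

theorem Move.step {c c' : GuessConfig α Δ K} {w : Option (Fin 2) × Option (QueryLetter α Δ)}
    (h : Move c w c') : (guesser α Δ K).Step c.toConfig w c'.toConfig := by
  have read_running (k : Fin (K + 1)) : GuessState.read k ∉ (guesser α Δ K).halt :=
    mt mem_halt_iff.1 nofun
  have pop_running : GuessState.pop ∉ (guesser α Δ K).halt := mt mem_halt_iff.1 nofun
  cases h with
  | guess h d u P => cases P <;> exact .silent (read_running _) (GuessTrans.guess h d _)
  | symbol k hs d u P => cases P <;> exact .read (read_running k) (GuessTrans.symbol k hs d _)
  | turn k d u P => cases P <;> exact .read (read_running k) (GuessTrans.turn k d _)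
  | pop d u P => exact .silent pop_running (GuessTrans.pop d)
  | finish u => exact .silent pop_running GuessTrans.finish

theorem exists_move_of_step {c : GuessConfig α Δ K}
    {w : Option (Fin 2) × Option (QueryLetter α Δ)} {c' : (guesser α Δ K).Config}
    (h : (guesser α Δ K).Step c.toConfig w c') :
    ∃ d : GuessConfig α Δ K, Move c w d ∧ c' = d.toConfig := by
  obtain ⟨q, u, P⟩ := c
  have pushed {v : List (Option Δ)} (hv : P.map some ++ [none] = v) (d : Δ) (q : GuessState K)
      (u : List (TapeSymbol α)) :
      (⟨q, u, some d :: v⟩ : (guesser α Δ K).Config) = toConfig ⟨q, u, d :: P⟩ := by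
    rw [← hv]
    rfl
  rw [toConfig] at h
  generalize hv : P.map some ++ [none] = v at h
  cases h with
  | read _ hm =>
    cases hm with
    | symbol k hs d => exact ⟨_, .symbol k hs d _ P, pushed hv d _ _⟩
    | turn k d => exact ⟨_, .turn k d _ P, pushed hv d _ _⟩
  | silent _ hm =>
    cases hm with
    | guess h d => exact ⟨_, .guess h d u P, pushed hv d _ _⟩
    | pop d =>
      obtain _ | ⟨_, P⟩ := P <;> cases hv
      exact ⟨_, .pop d u P, rfl⟩
    | finish =>
      obtain _ | ⟨_, P⟩ := P <;> cases hv
      exact ⟨_, .finish u, rfl⟩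

theorem run_invariant {c : GuessConfig α Δ K}
    {l : List (Option (Fin 2) × Option (QueryLetter α Δ))} {c' : (guesser α Δ K).Config}
    (h : (guesser α Δ K).Run c.toConfig l c') (hc : c.Live) :
    ∃ d : GuessConfig α Δ K, c' = d.toConfig ∧ d.Live ∧ d.potential + l.length ≤ c.potential := by
  induction l generalizing c with
  | nil => cases h; exact ⟨c, rfl, hc, le_rfl⟩
  | cons w l ih =>
    obtain _ | ⟨hs, hr⟩ := h
    obtain ⟨c₁, hm, rfl⟩ := exists_move_of_step hs
    obtain ⟨d, rfl, hd, hle⟩ := ih hr (hm.live hc)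
    exact ⟨d, rfl, hd, Nat.lt_of_le_of_lt hle hm.potential_lt⟩

theorem terminates_guesser [Nonempty Δ] : (guesser α Δ K).Terminates := by
  refine ⟨2 * K + 3, 2 * K + (2 * K + 3) * 2, fun x l c h => ?_⟩
  obtain ⟨d, rfl, hd, hle⟩ := run_invariant
    (c := ⟨.read (Fin.last K), tape x, []⟩) h fun _ _ => by simp [tape]
  refine ⟨?_, fun hd' => ?_⟩
  · have initial_potential : potential (Δ := Δ) ⟨.read (Fin.last K), tape x, []⟩ =
        (2 * K + 3) * x.length + (2 * K + (2 * K + 3) * 2) := by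
      simp only [potential, tape, List.length_cons, List.length_append, List.length_map,
        List.length_nil, Fin.val_last]
      ring
    omega
  · obtain ⟨w, d', hm⟩ := hd.exists_move (mt mem_halt_iff.2 hd')
    exact ⟨w, _, hm.step⟩

/-- The emissions of the guessing npda on the accepting computation paths on which it guesses
and reads `t` and then pops `P`. -/
def emissions (t : List (Option (TapeSymbol α) × Δ)) (P : List Δ) :
    List (Option (Fin 2) × Option (QueryLetter α Δ)) :=
  t.map (fun c => (none, some (.inl c))) ++
    (P.map (fun d => (none, some (.inr d))) ++ [(some 1, none)])

theorem eq_emissions_of_run_pop {u : List (TapeSymbol α)} {P : List Δ}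
    {l : List (Option (Fin 2) × Option (QueryLetter α Δ))} {c' : (guesser α Δ K).Config}
    (h : (guesser α Δ K).Run (toConfig ⟨.pop, u, P⟩) l c') (hc' : c'.state = GuessState.accept) :
    l = emissions [] P := by
  induction P generalizing l with
  | nil =>
    obtain _ | ⟨hs, hr⟩ := h
    · cases hc'
    obtain ⟨_, ⟨⟩, rfl⟩ := exists_move_of_step hs
    obtain _ | ⟨hs, -⟩ := hr
    · rfl
    · obtain ⟨_, ⟨⟩, -⟩ := exists_move_of_step hs
  | cons d P ih =>
    obtain _ | ⟨hs, hr⟩ := h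
    · cases hc'
    obtain ⟨_, ⟨⟩, rfl⟩ := exists_move_of_step hs
    rw [ih hr]
    rfl

theorem exists_eq_emissions_of_run_read {k : Fin (K + 1)} {u : List (TapeSymbol α)}
    (hu : TapeSymbol.right ∉ u) {P : List Δ}
    {l : List (Option (Fin 2) × Option (QueryLetter α Δ))} {c' : (guesser α Δ K).Config}
    (h : (guesser α Δ K).Run (toConfig ⟨.read k, u ++ [.right], P⟩) l c')
    (hc' : c'.state = GuessState.accept) :
    ∃ t, t.filterMap Prod.fst = u ++ [.right] ∧
      l = emissions t ((t.map Prod.snd).reverse ++ P) := by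
  induction l generalizing k u P with
  | nil => cases h; cases hc'
  | cons w l ih =>
    obtain _ | ⟨hs, hr⟩ := h
    obtain ⟨c₁, hm, rfl⟩ := exists_move_of_step hs
    generalize hv : u ++ [TapeSymbol.right] = v at hm
    cases hm with
    | guess _ d =>
      obtain ⟨t, ht, rfl⟩ := ih hu (hv ▸ hr)
      exact ⟨(none, d) :: t, hv ▸ ht, by simp [emissions]⟩
    | @symbol _ s hne d =>
      obtain _ | ⟨_, u⟩ := u
      · cases hv; exact absurd rfl hne
      · cases hv
        obtain ⟨t, ht, rfl⟩ := ih (List.not_mem_of_not_mem_cons hu) hr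
        exact ⟨(some s, d) :: t, congrArg (s :: ·) ht, by simp [emissions]⟩
    | turn _ d =>
      obtain _ | ⟨s, u⟩ := u
      · cases hv
        exact ⟨[(some .right, d)], rfl, congrArg (_ :: ·) (eq_emissions_of_run_pop hr hc')⟩
      · cases hv
        exact absurd List.mem_cons_self hu

theorem run_pop (u : List (TapeSymbol α)) (P : List Δ) :
    (guesser α Δ K).Run (toConfig ⟨.pop, u, P⟩) (emissions [] P) (toConfig ⟨.accept, u, []⟩) := by
  induction P with
  | nil => exact .cons (Move.finish u).step (.nil _)
  | cons d P ih => exact .cons (Move.pop d u P).step ih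

theorem exists_run_read {u : List (TapeSymbol α)} (hu : TapeSymbol.right ∉ u) (k : Fin (K + 1))
    (P : List Δ) {G : List Δ} (hle : u.length + 1 ≤ G.length)
    (hge : G.length ≤ k + 1 + (K + 1) * u.length) :
    ∃ t, t.filterMap Prod.fst = u ++ [.right] ∧ t.map Prod.snd = G ∧
      (guesser α Δ K).Run (toConfig ⟨.read k, u ++ [.right], P⟩) (emissions t (G.reverse ++ P))
        (toConfig ⟨.accept, [], []⟩) := by
  induction G generalizing u k P with
  | nil => cases hle
  | cons d G ih =>
    rw [List.length_cons] at hle hge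
    rw [List.reverse_cons, List.append_assoc, List.singleton_append]
    by_cases hguess : 0 < (k : ℕ) ∧ u.length + 1 ≤ G.length
    · obtain ⟨t, ht, rfl, hr⟩ := ih hu ⟨k - 1, by omega⟩ (d :: P) hguess.2 (by simp only; omega)
      refine ⟨(none, d) :: t, ht, rfl, .cons (Move.guess ?_ d _ P).step hr⟩
      simp only
      omega
    · obtain _ | ⟨s, u⟩ := u
      · obtain rfl : G = [] := by
          rw [List.length_nil] at *
          exact List.length_eq_zero_iff.1 (by omega)
        exact ⟨[(some .right, d)], rfl, rfl, .cons (Move.turn k d [] P).step (run_pop [] (d :: P))⟩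
      · rw [List.length_cons, mul_add, mul_one] at *
        have budget : u.length ≤ (K + 1) * u.length := Nat.le_mul_of_pos_left _ K.succ_pos
        obtain ⟨t, ht, rfl, hr⟩ := ih (List.not_mem_of_not_mem_cons hu) (Fin.last K) (d :: P)
          (by omega) (by rw [Fin.val_last]; omega)
        exact ⟨(some s, d) :: t, congrArg (s :: ·) ht, rfl,
          .cons (Move.symbol k (fun h => hu (h ▸ List.mem_cons_self)) d _ P).step hr⟩

end GuessConfig

theorem accepts_emissions {α Δ : Type} [Finite α] [Finite Δ] {K : ℕ} {x : List α} {G : List Δ}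
    (hle : x.length + 2 ≤ G.length) (hge : G.length ≤ (K + 1) * (x.length + 2)) :
    ∃ t, t.filterMap Prod.fst = tape x ∧ t.map Prod.snd = G ∧
      (guesser α Δ K).Accepts x (GuessConfig.emissions t G.reverse) := by
  have right_notMem : TapeSymbol.right ∉ TapeSymbol.left :: x.map TapeSymbol.sym := by simp
  obtain ⟨t, ht, hG, hr⟩ := GuessConfig.exists_run_read right_notMem (Fin.last K) []
    (G := G) (by rwa [List.length_cons, List.length_map]) (by
      simp only [Fin.val_last, List.length_cons, List.length_map]
      linarith)
  rw [List.append_nil] at hr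
  exact ⟨t, ht, hG, _, hr, rfl⟩

theorem exists_eq_emissions_of_accepts {α Δ : Type} [Finite α] [Finite Δ] {K : ℕ} {x : List α}
    {l : List (Option (Fin 2) × Option (QueryLetter α Δ))} (h : (guesser α Δ K).Accepts x l) :
    ∃ t, t.filterMap Prod.fst = tape x ∧
      l = GuessConfig.emissions t (t.map Prod.snd).reverse := by
  have right_notMem : TapeSymbol.right ∉ TapeSymbol.left :: x.map TapeSymbol.sym := by simp
  obtain ⟨c, hr, hc⟩ := h
  obtain ⟨t, ht, rfl⟩ := GuessConfig.exists_eq_emissions_of_run_read right_notMem (P := []) hr hc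
  exact ⟨t, ht, by rw [List.append_nil]⟩

theorem mem_CFLmOracle_of_query {α Δ : Type} [Finite α] [Finite Δ] [Nonempty Δ]
    {A : Language (QueryLetter α Δ)} {L : Language α} (K : ℕ)
    (sound : ∀ x t, t.filterMap Prod.fst = tape x → query t ∈ A → x ∈ L)
    (complete : ∀ x ∈ L, ∃ G : List Δ, x.length + 2 ≤ G.length ∧
      G.length ≤ (K + 1) * (x.length + 2) ∧
      ∀ t, t.filterMap Prod.fst = tape x → t.map Prod.snd = G → query t ∈ A) :
    L ∈ CFLmOracle A α := by
  have query_eq (t : List (Option (TapeSymbol α) × Δ)) :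
      ((GuessConfig.emissions t (t.map Prod.snd).reverse).map Prod.snd).reduceOption =
        query t := by
    simp [GuessConfig.emissions, query, List.reduceOption, List.filterMap_map, Function.comp_def]
  have output_eq (t : List (Option (TapeSymbol α) × Δ)) (P : List Δ) :
      ((GuessConfig.emissions t P).map Prod.fst).reduceOption = [1] := by
    simp [GuessConfig.emissions, List.reduceOption, List.filterMap_map]
  refine ⟨⟨guesser α Δ K, GuessConfig.terminates_guesser, fun x => ?_⟩, ?_⟩
  · ext z
    constructor
    · rintro ⟨hx, rfl⟩
      obtain ⟨G, hle, hge, hG⟩ := complete x hx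
      obtain ⟨t, ht, rfl, h⟩ := accepts_emissions hle hge
      exact ⟨_, h, (query_eq t).symm ▸ hG t ht rfl, (output_eq t _).symm⟩
    · rintro ⟨l, h, hA, rfl⟩
      obtain ⟨t, ht, rfl⟩ := exists_eq_emissions_of_accepts h
      exact ⟨sound x t ht (query_eq t ▸ hA), output_eq t _⟩
  · rintro x _ ⟨-, rfl⟩ _ ⟨-, rfl⟩
    rfl

/-! ### The two oracles -/

/-- The letters guessed by the oracle npda: those of a two-track string, of a reversed history and
of a history. -/
inductive GuessLetter (α γ : Type) : Type
  | pair : Option α × Option γ → GuessLetter α γ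
  | rev : Option (TapeSymbol α) × Option γ → GuessLetter α γ
  | hist : Option (TapeSymbol α) × Option γ → GuessLetter α γ

section Oracles

open GuessLetter

variable {α γ : Type}

instance [Finite α] [Finite γ] : Finite (GuessLetter α γ) :=
  Finite.of_surjective (fun o : (Option α × Option γ) ⊕ (Option (TapeSymbol α) × Option γ) ⊕
      (Option (TapeSymbol α) × Option γ) => o.elim pair (Sum.elim rev hist)) fun
    | pair c => ⟨.inl c, rfl⟩
    | rev d => ⟨.inr (.inl d), rfl⟩
    | hist d => ⟨.inr (.inr d), rfl⟩

instance : Nonempty (GuessLetter α γ) := ⟨pair (none, none)⟩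

/-- The guesses for the two-track string `u` and the history `w`. -/
def guess (u : List (Option α × Option γ)) (w : List (Option (TapeSymbol α) × Option γ)) :
    List (GuessLetter α γ) :=
  u.map pair ++ (w.reverse.map rev ++ w.map hist)

/-- The input symbol read in a letter of a computation history. -/
def inputSymbol (d : Option (TapeSymbol α) × Option γ) : Option α :=
  d.1.bind fun
    | .sym a => some a
    | _ => none

/-- The guess in a query letter of the guessing phase. -/
def guessed? : QueryLetter α (GuessLetter α γ) → Option (GuessLetter α γ) :=
  Sum.elim (some ∘ Prod.snd) fun _ => none

/-- The letters of the guessing phase on the left, and the repeated letters of the history on the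
right. -/
def symbolOrHist? : QueryLetter α (GuessLetter α γ) →
    Option (Option (TapeSymbol α) ⊕ (Option (TapeSymbol α) × Option γ))
  | .inl (s, _) => some (.inl s)
  | .inr (hist d) => some (.inr d)
  | _ => none

/-- The guesses in which the two-track string belongs to `B` and the reversed history is the
reversal of the history. -/
def forwardCheck (B : Language (Option α × Option γ)) : Language (GuessLetter α γ) :=
  Language.map pair B * Language.map (Sum.elim rev hist) (mirror ⊤ some some)

/-- The repeated guesses in which the history is one of `M` and the upper track is the input. -/
def backwardCheck (M : NPDA α (Option γ)) : Language (GuessLetter α γ) :=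
  Language.map hist M.histories.reverse *
    Language.map (Sum.elim rev pair) (mirror (trackWords α γ) inputSymbol Prod.fst)

/-- The first oracle. -/
def oracle₁ (B : Language (Option α × Option γ)) (M : NPDA α (Option γ)) :
    Language (QueryLetter α (GuessLetter α γ)) :=
  comap guessed? (forwardCheck B) * Language.map .inr (backwardCheck M)

/-- The second oracle: the history reads the tape contents, and the lower track is the output. -/
def oracle₂ (α γ : Type) : Language (QueryLetter α (GuessLetter α γ)) :=
  comap symbolOrHist? (mirror ⊤ id Prod.fst) *
    Language.map (.inr ∘ Sum.elim rev pair) (mirror ⊤ Prod.snd Prod.snd)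

theorem isContextFree_oracle₁ [Finite α] [Finite γ] {B : Language (Option α × Option γ)}
    (hB : B.IsContextFree) (M : NPDA α (Option γ)) : (oracle₁ B M).IsContextFree :=
  isContextFree_mul
    (isContextFree_comap _ (isContextFree_mul (isContextFree_map _ hB)
      (isContextFree_map _ (isContextFree_mirror isRegular_top _ _))))
    (isContextFree_map _ (isContextFree_mul
      (isContextFree_map _ M.isContextFree_histories.reverse)
      (isContextFree_map _ (isContextFree_mirror isRegular_trackWords _ _))))

theorem isContextFree_oracle₂ [Finite α] [Finite γ] : (oracle₂ α γ).IsContextFree :=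
  isContextFree_mul
    (isContextFree_comap _ (isContextFree_mirror isRegular_top _ _))
    (isContextFree_map _ (isContextFree_mirror isRegular_top _ _))

theorem map_mem_map_iff {S T : Type} {f : S → T} (hf : f.Injective) {L : Language S}
    {l : List S} : l.map f ∈ Language.map f L ↔ l ∈ L :=
  (List.map_injective_iff.2 hf).mem_set_image

theorem mem_range_of_mem_map {S T : Type} {f : S → T} {L : Language S} :
    ∀ s ∈ Language.map f L, ∀ c ∈ s, c ∈ Set.range f := by
  rintro _ ⟨l, -, rfl⟩ c hc
  exact (List.mem_map.1 hc).imp fun _ => And.right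

theorem mem_forwardCheck_iff {B : Language (Option α × Option γ)} {G : List (GuessLetter α γ)} :
    G ∈ forwardCheck B ↔ ∃ u ∈ B, ∃ w, G = guess u w := by
  constructor
  · rintro ⟨_, ⟨u, hu, rfl⟩, _, ⟨_, ⟨p, r, -, hpr, rfl⟩, rfl⟩, rfl⟩
    obtain rfl : p = r := by simpa using hpr
    exact ⟨u, hu, p.reverse, by simp [guess]⟩
  · rintro ⟨u, hu, w, rfl⟩
    refine Language.append_mem_mul ⟨u, hu, rfl⟩ ⟨_, ⟨w.reverse, w.reverse, trivial, rfl, rfl⟩, ?_⟩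
    simp

theorem map_revPair_mem_map_iff {T κ : Type} {i : GuessLetter α γ → T} (hi : i.Injective)
    {L : Language (Option α × Option γ)} {f : Option (TapeSymbol α) × Option γ → Option κ}
    {g : Option α × Option γ → Option κ} {u : List (Option α × Option γ)}
    {w : List (Option (TapeSymbol α) × Option γ)} :
    (w.map rev ++ (u.map pair).reverse).map i ∈
        Language.map (i ∘ Sum.elim rev pair) (mirror L f g) ↔
      u ∈ L ∧ w.filterMap f = u.filterMap g := by
  have injective : (i ∘ Sum.elim (rev (α := α) (γ := γ)) pair).Injective :=
    hi.comp (Function.Injective.sumElim (fun _ _ => rev.inj) (fun _ _ => pair.inj) nofun)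
  rw [← mem_mirror_iff, ← map_mem_map_iff injective]
  simp [Function.comp_assoc]

theorem reverse_guess_mem_backwardCheck_iff {M : NPDA α (Option γ)}
    {u : List (Option α × Option γ)} {w : List (Option (TapeSymbol α) × Option γ)} :
    (guess u w).reverse ∈ backwardCheck M ↔ w ∈ M.histories ∧ u ∈ trackWords α γ ∧
      w.filterMap inputSymbol = u.filterMap Prod.fst := by
  have reverse_guess : (guess u w).reverse =
      w.reverse.map hist ++ (w.map rev ++ (u.map pair).reverse).map id := by
    simp [guess]
  rw [reverse_guess, backwardCheck, append_mem_mul_iff (P := (· ∈ Set.range hist))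
    mem_range_of_mem_map, map_mem_map_iff fun _ _ => hist.inj, Language.mem_reverse,
    List.reverse_reverse]
  · exact and_congr_right fun _ => map_revPair_mem_map_iff Function.injective_id
  · rintro s hs c hc ⟨d, rfl⟩
    obtain ⟨_ | _, ⟨⟩⟩ := mem_range_of_mem_map s hs _ hc
  · exact List.forall_mem_map.2 fun d _ => ⟨d, rfl⟩
  · simp only [List.forall_mem_append, List.mem_reverse, List.forall_mem_map]
    exact ⟨fun _ _ => nofun, fun _ _ => nofun⟩

variable {t : List (Option (TapeSymbol α) × GuessLetter α γ)}

theorem query_mem_oracle₁_iff {B : Language (Option α × Option γ)} {M : NPDA α (Option γ)} :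
    query t ∈ oracle₁ B M ↔ t.map Prod.snd ∈ forwardCheck B ∧
      (t.map Prod.snd).reverse ∈ backwardCheck M := by
  rw [query, oracle₁, append_mem_mul_iff (P := fun c => (guessed? c).isSome)
    (fun s hs c => isSome_of_mem_comap hs), map_mem_map_iff Sum.inr_injective,
    mem_comap_iff (l := t.map Prod.snd)]
  · simp [guessed?]
  · rintro s hs c hc
    obtain ⟨e, rfl⟩ := mem_range_of_mem_map s hs c hc
    simp [guessed?]
  · simp [guessed?]
  · simp [guessed?]

theorem query_mem_oracle₂_iff {u : List (Option α × Option γ)}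
    {w : List (Option (TapeSymbol α) × Option γ)} (ht : t.map Prod.snd = guess u w) :
    query t ∈ oracle₂ α γ ↔ t.filterMap Prod.fst = w.filterMap Prod.fst ∧
      w.filterMap Prod.snd = u.filterMap Prod.snd := by
  have query_eq : query t = (t.map .inl ++ (w.map (.inr ∘ hist)).reverse) ++
      (w.map rev ++ (u.map pair).reverse).map .inr := by
    simp [query, ht, guess]
  rw [query_eq, oracle₂, append_mem_mul_iff (P := fun c => (symbolOrHist? c).isSome)
    (fun s hs c => isSome_of_mem_comap hs), map_revPair_mem_map_iff Sum.inr_injective,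
    mem_comap_iff (l := (t.map Prod.fst).map .inl ++ (w.map .inr).reverse), mem_mirror_iff]
  · rw [List.filterMap_map]
    exact and_congr (and_iff_right trivial) (and_iff_right trivial)
  · simp only [List.map_append, List.map_map, List.map_reverse]
    rfl
  · rintro s hs c hc
    obtain ⟨_ | _, rfl⟩ := mem_range_of_mem_map s hs c hc <;> simp [symbolOrHist?]
  · simp only [List.forall_mem_append, List.mem_reverse, List.forall_mem_map]
    exact ⟨fun _ _ => rfl, fun _ _ => rfl⟩
  · simp only [List.forall_mem_append, List.mem_reverse, List.forall_mem_map]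
    exact ⟨fun _ _ => nofun, fun _ _ => nofun⟩

theorem filterMap_inputSymbol {w : List (Option (TapeSymbol α) × Option γ)} {x : List α}
    (h : w.filterMap Prod.fst = tape x) : w.filterMap inputSymbol = x := by
  unfold inputSymbol
  rw [← List.filterMap_filterMap, h]
  simp [tape, List.filterMap_map]

end Oracles

/-! ### Advice and complements -/

theorem mem_of_query_mem_oracles {α γ : Type} {B : Language (Option α × Option γ)}
    {M : NPDA α (Option γ)} {x : List α} {t : List (Option (TapeSymbol α) × GuessLetter α γ)}
    (hx : t.filterMap Prod.fst = tape x) (h₁ : query t ∈ oracle₁ B M)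
    (h₂ : query t ∈ oracle₂ α γ) : ∃ y ∈ M.outcomes x, track x y ∈ B := by
  rw [query_mem_oracle₁_iff, mem_forwardCheck_iff] at h₁
  obtain ⟨⟨u, hu, w, ht⟩, h₁⟩ := h₁
  rw [ht, reverse_guess_mem_backwardCheck_iff] at h₁
  obtain ⟨hw, ⟨x', y, rfl⟩, upper⟩ := h₁
  obtain ⟨tape_eq, lower⟩ := (query_mem_oracle₂_iff ht).1 h₂
  have history_tape : w.filterMap Prod.fst = tape x := tape_eq.symm.trans hx
  rw [filterMap_inputSymbol history_tape, filterMap_fst_track] at upper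
  rw [filterMap_snd_track] at lower
  subst upper lower
  exact ⟨_, NPDA.mem_outcomes_of_history hw history_tape, hu⟩

theorem query_mem_oracles {α γ : Type} {B : Language (Option α × Option γ)}
    {M : NPDA α (Option γ)} {x : List α} {w : List (Option (TapeSymbol α) × Option γ)}
    (hw : w ∈ M.histories) (hwx : w.filterMap Prod.fst = tape x)
    (hB : track x (w.filterMap Prod.snd) ∈ B)
    {t : List (Option (TapeSymbol α) × GuessLetter α γ)} (htx : t.filterMap Prod.fst = tape x)
    (ht : t.map Prod.snd = guess (track x (w.filterMap Prod.snd)) w) :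
    query t ∈ oracle₁ B M ∧ query t ∈ oracle₂ α γ := by
  constructor
  · rw [query_mem_oracle₁_iff, mem_forwardCheck_iff, ht, reverse_guess_mem_backwardCheck_iff,
      filterMap_inputSymbol hwx, filterMap_fst_track]
    exact ⟨⟨_, hB, w, rfl⟩, hw, ⟨x, _, rfl⟩, rfl⟩
  · rw [query_mem_oracle₂_iff ht, htx, hwx, filterMap_snd_track]
    exact ⟨rfl, rfl⟩

theorem length_guess_track {α γ : Type} {x : List α} {a b : ℕ}
    {w : List (Option (TapeSymbol α) × Option γ)} (hwx : w.filterMap Prod.fst = tape x)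
    (hw : w.length ≤ a * x.length + b) :
    x.length + 2 ≤ (guess (track x (w.filterMap Prod.snd)) w).length ∧
      (guess (track x (w.filterMap Prod.snd)) w).length ≤ (3 * (a + b) + 1) * (x.length + 2) := by
  have length_guess : (guess (track x (w.filterMap Prod.snd)) w).length =
      (track x (w.filterMap Prod.snd)).length + 2 * w.length := by
    simp only [guess, List.length_append, List.length_map, List.length_reverse]
    ring
  have length_tape : x.length + 2 ≤ w.length := by
    simpa only [hwx, tape, List.length_cons, List.length_append, List.length_map,
      List.length_nil] using List.length_filterMap_le Prod.fst w
  have length_track := length_track_le x (w.filterMap Prod.snd)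
  have length_output := List.length_filterMap_le Prod.snd w
  rw [length_guess]
  constructor
  · omega
  · nlinarith

theorem advice_CFL_CFLMV_subset (α : Type) [Finite α] :
    advice CFL CFLMV α ⊆ CFLm (CFLConj 2) α := by
  rintro _ ⟨γ, _, B, hB, h, ⟨M, hM, hMh⟩, rfl⟩
  obtain ⟨a, b, exists_history⟩ := NPDA.exists_history hM
  refine ⟨QueryLetter α (GuessLetter α γ), inferInstance,
    {s | ∀ i, s ∈ ![oracle₁ B M, oracle₂ α γ] i}, ⟨_, ?_, rfl⟩,
    mem_CFLmOracle_of_query (3 * (a + b)) ?_ ?_⟩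
  · exact Fin.forall_fin_two.2 ⟨isContextFree_oracle₁ hB M, isContextFree_oracle₂⟩
  · intro x t hx hA
    obtain ⟨y, hy, hyB⟩ := mem_of_query_mem_oracles hx (hA 0) (hA 1)
    exact ⟨y, hMh x ▸ hy, hyB⟩
  · rintro x ⟨y, hy, hB⟩
    obtain ⟨w, hw, hwx, rfl, hlen⟩ := exists_history x y (hMh x ▸ hy)
    obtain ⟨hle, hge⟩ := length_guess_track hwx hlen
    exact ⟨_, hle, hge, fun t htx ht =>
      Fin.forall_fin_two.2 (query_mem_oracles hw hwx hB htx ht)⟩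

theorem advice_mono {C C' : LanguageFamily} {F F' : FunctionFamily} {α : Type} [Finite α]
    (hC : ∀ γ : Type, Finite γ → C γ ⊆ C' γ) (hF : ∀ γ, F α γ ⊆ F' α γ) :
    advice C F α ⊆ advice C' F' α := by
  rintro L ⟨γ, _, B, hB, h, hh, hL⟩
  exact ⟨γ, ‹_›, B, hC _ inferInstance hB, h, hF γ hh, hL⟩

theorem CFLSVt_subset_CFLMV (α γ : Type) : CFLSVt α γ ⊆ CFLMV α γ := fun _ hf => hf.1.1

theorem advice_REG_CFLSVt_subset (α : Type) [Finite α] :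
    advice REG CFLSVt α ⊆ advice CFL CFLMV α :=
  advice_mono (fun _ _ _ => isContextFree_of_isRegular) (CFLSVt_subset_CFLMV α)

theorem advice_REG_CFLSVt_subset_co (α : Type) :
    advice REG CFLSVt α ⊆ co (advice REG CFLSVt) α := by
  rintro _ ⟨γ, hγ, B, hB, h, hh, rfl⟩
  refine ⟨γ, hγ, Bᶜ, Language.IsRegular.compl hB, h, hh, ?_⟩
  ext x
  obtain ⟨y, hy⟩ := hh.2 x
  have singleton : h x = {y} := (hh.1.2 x).eq_singleton_of_mem hy
  change (¬ ∃ y ∈ h x, track x y ∈ B) ↔ ∃ y ∈ h x, track x y ∉ B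
  simp [singleton]

theorem CFLConj_mono {k m : ℕ} [NeZero k] (hkm : k ≤ m) (α : Type) :
    CFLConj k α ⊆ CFLConj m α := by
  rintro _ ⟨A, hA, rfl⟩
  have surjective : Function.Surjective fun i : Fin m => Fin.ofNat k i :=
    fun j => ⟨j.castLE hkm, Fin.ofNat_val_eq_self j⟩
  exact ⟨fun i => A (Fin.ofNat k i), fun _ => hA _, Set.ext fun _ => surjective.forall⟩

theorem CFLm_mono {C C' : LanguageFamily} (h : ∀ δ, C δ ⊆ C' δ) (α : Type) :
    CFLm C α ⊆ CFLm C' α :=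
  fun _ ⟨δ, hδ, A, hA, hL⟩ => ⟨δ, hδ, A, h δ hA, hL⟩

end CFLFun

theorem mainTheorem10_general (α : Type) [Finite α] :
    CFLFun.advice CFLFun.CFL CFLFun.CFLMV α ⊆ CFLFun.CFLm (CFLFun.CFLConj 2) α ∧
      CFLFun.advice CFLFun.REG CFLFun.CFLSVt α ⊆
        CFLFun.co (CFLFun.CFLm (CFLFun.CFLConj 2)) α := by
  have relativization := CFLFun.advice_CFL_CFLMV_subset α
  have regular_advice := CFLFun.advice_REG_CFLSVt_subset α
  exact ⟨relativization, fun _ hL =>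
    relativization (regular_advice (CFLFun.advice_REG_CFLSVt_subset_co α hL))⟩

theorem mainTheorem10 (α : Type) [Finite α] :
    CFLFun.advice CFLFun.REG CFLFun.CFLSVt α ⊆
        CFLFun.CFLm (CFLFun.CFLConj 2) α ∩ CFLFun.co (CFLFun.CFLm (CFLFun.CFLConj 2)) α ∧
      CFLFun.advice CFLFun.CFL CFLFun.CFLSVt α ⊆ CFLFun.CFLm (CFLFun.CFLConj 3) α := by
  obtain ⟨relativization, complement⟩ := mainTheorem10_general α
  exact ⟨Set.subset_inter ((CFLFun.advice_REG_CFLSVt_subset α).trans relativization) complement,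
    (CFLFun.advice_mono (fun _ _ => subset_rfl) (CFLFun.CFLSVt_subset_CFLMV α)).trans
      (relativization.trans (CFLFun.CFLm_mono (CFLFun.CFLConj_mono (Nat.le_succ 2)) α))⟩
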